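/- Let $n\ge 0$ and let $\mathfrak S_n$ be the symmetric group, with simple reflections $s_i=(i\ \,i{+}1)$, $1\le i\le n-1$, length function $\ell$ (the least length of a word in the $s_i$), and reflections the conjugates of the $s_i$. The directed Bruhat graph has vertex set $\mathfrak S_n$ and an edge $u\to ut$ whenever $t$ is a reflection and $\ell(ut)>\ell(u)$. The Bruhat order $\le$ is the reflexive transitive closure of this relation. For $w\in\mathfrak S_n$ let $\Gamma(e,w)$ be the simple undirected graph underlying the restriction of the directed Bruhat graph to the interval $[e,w]=\{x : e\le x\le w\}$. For $J\subseteq S=\{s_1,\dots,s_{n-1}\}$ let $w_0(J)$ be the longest element of the subgroup generated by $J$. The Dynkin diagram is the graph on $S$ in which two distinct simple reflections are adjacent when they do not commute. Call $w$ almost-polished if there are $k\ge 0$, pairwise disjoint subsets $S_1,\dots,S_k\subseteq S$, each a connected subset of the Dynkin diagram, and (not necessarily disjoint) subsets $J_i,J_i'\subseteq S$ with $S_i=J_i\cup J_i'$ such that $$w=\prod_{i=1}^k w_0(J_i)\,w_0(J_i\cap J_i')\,w_0(J_i'),$$ the product being taken in the order $i=1,\dots,k$. **Theorem.** For every $w\in\mathfrak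 S_n$ the following are equivalent: 1. the undirected graph $\Gamma(e,w)$ is vertex-transitive, that is, its automorphism group acts transitively on its vertices; 2. $w$ avoids the patterns $3412$, $4231$, $34521$ and $54123$; 3. $w$ is almost-polished. -/

import Mathlib

namespace BruhatGraph

/-- The simple reflection `s_i` of the symmetric group on `Fin n` : the adjacent transposition
exchanging positions `i` and `i + 1`.  The index set `Fin (n - 1)` plays the role of the set `S`
of simple generators (it is empty for `n ≤ 1`). -/
def simple (n : ℕ) (i : Fin (n - 1)) : Equiv.Perm (Fin n) :=
  Equiv.swap ⟨i.val, by omega⟩ ⟨i.val + 1, by omega⟩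

/-- The product `s_{i_1} ⋯ s_{i_k}` of a word in the simple reflections. -/
def wordProd (n : ℕ) (l : List (Fin (n - 1))) : Equiv.Perm (Fin n) :=
  (l.map (simple n)).prod

/-- The Coxeter length: the least length of a word in the simple reflections with product `w`
(such words exist for every `w`, see `exists_wordProd`). -/
noncomputable def length {n : ℕ} (w : Equiv.Perm (Fin n)) : ℕ :=
  sInf {k : ℕ | ∃ l : List (Fin (n - 1)), l.length = k ∧ wordProd n l = w}

/-- The simple reflections generate the symmetric group, so `length` is never a junk value. -/
theorem exists_wordProd {n : ℕ} (w : Equiv.Perm (Fin n)) :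
    ∃ l : List (Fin (n - 1)), wordProd n l = w := by
  cases n with
  | zero => exact ⟨[], Subsingleton.elim _ _⟩
  | succ m =>
    have h : w ∈ Submonoid.closure (Set.range (simple (m + 1))) := by
      have h2 := Equiv.Perm.mclosure_swap_castSucc_succ m
      have h3 : (simple (m + 1)) =
          fun i : Fin m => Equiv.swap i.castSucc i.succ := by
        funext i
        rfl
      rw [h3]
      have h4 : w ∈ (⊤ : Submonoid (Equiv.Perm (Fin (m + 1)))) := Submonoid.mem_top w
      rwa [← h2] at h4
    induction h using Submonoid.closure_induction with
    | mem x hx =>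
      obtain ⟨i, rfl⟩ := hx
      exact ⟨[i], by simp [wordProd]⟩
    | one => exact ⟨[], rfl⟩
    | mul x y _ _ hx hy =>
      obtain ⟨a, rfl⟩ := hx
      obtain ⟨b, rfl⟩ := hy
      exact ⟨a ++ b, by simp [wordProd]⟩

/-- Reflections: the conjugates of the simple reflections. -/
def IsReflection {n : ℕ} (t : Equiv.Perm (Fin n)) : Prop :=
  ∃ (g : Equiv.Perm (Fin n)) (i : Fin (n - 1)), t = g * simple n i * g⁻¹

/-- The edges `u → u t` of the directed Bruhat graph, `t` a reflection with `ℓ(u t) > ℓ(u)`. -/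
def DirEdge {n : ℕ} (u v : Equiv.Perm (Fin n)) : Prop :=
  ∃ t : Equiv.Perm (Fin n), IsReflection t ∧ v = u * t ∧ length u < length v

/-- The (strong) Bruhat order: the reflexive transitive closure of the directed Bruhat graph. -/
def Le {n : ℕ} (u v : Equiv.Perm (Fin n)) : Prop :=
  Relation.ReflTransGen DirEdge u v

/-- The Bruhat interval `[u, v]`. -/
def interval {n : ℕ} (u v : Equiv.Perm (Fin n)) : Set (Equiv.Perm (Fin n)) :=
  {x | Le u x ∧ Le x v}

/-- The undirected Bruhat graph of the symmetric group: the simple undirected graph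
underlying the directed Bruhat graph. -/
def bruhatGraph (n : ℕ) : SimpleGraph (Equiv.Perm (Fin n)) :=
  SimpleGraph.fromRel DirEdge

/-- The undirected Bruhat graph `Γ(u, v)`: the induced subgraph on the interval `[u, v]`. -/
def intervalGraph {n : ℕ} (u v : Equiv.Perm (Fin n)) : SimpleGraph (interval u v) :=
  (bruhatGraph n).induce (interval u v)

/-- A graph is vertex-transitive if its automorphism group acts transitively on vertices. -/
def IsVertexTransitive {V : Type*} (G : SimpleGraph V) : Prop :=
  ∀ x y : V, ∃ φ : G ≃g G, φ x = y

/-- `w` contains the pattern `p` (given in one-line notation) if there are positions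
`a_1 < ⋯ < a_k` such that `w(a_1), …, w(a_k)` are in the same relative order as
`p_1, …, p_k`. -/
def ContainsPattern {n k : ℕ} (w : Equiv.Perm (Fin n)) (p : Fin k → ℕ) : Prop :=
  ∃ a : Fin k → Fin n, StrictMono a ∧ ∀ i j : Fin k, w (a i) < w (a j) ↔ p i < p j

/-- `w` avoids the pattern `p`. -/
def AvoidsPattern {n k : ℕ} (w : Equiv.Perm (Fin n)) (p : Fin k → ℕ) : Prop :=
  ¬ ContainsPattern w p

/-- The parabolic subgroup `W_J` generated by the simple reflections indexed by `J`. -/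
def parabolic {n : ℕ} (J : Set (Fin (n - 1))) : Subgroup (Equiv.Perm (Fin n)) :=
  Subgroup.closure (simple n '' J)

theorem exists_longest {n : ℕ} (J : Set (Fin (n - 1))) :
    ∃ x ∈ parabolic J, ∀ y ∈ parabolic J, length y ≤ length x :=
  Set.exists_max_image (parabolic J : Set (Equiv.Perm (Fin n))) length (Set.toFinite _)
    ⟨1, (parabolic J).one_mem⟩

/-- `w_0(J)`, the element of maximal length of the parabolic subgroup `W_J`. -/
noncomputable def longest {n : ℕ} (J : Set (Fin (n - 1))) : Equiv.Perm (Fin n) :=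
  (exists_longest J).choose

/-- The Dynkin diagram of the symmetric group: distinct simple reflections are joined when they
do not commute. -/
def dynkin (n : ℕ) : SimpleGraph (Fin (n - 1)) :=
  SimpleGraph.fromRel fun i j => ¬ Commute (simple n i) (simple n j)

/-- Almost-polished permutations: ordered products of elements
`w_0(J_i) w_0(J_i ∩ J_i') w_0(J_i')`, where the sets `S_i = J_i ∪ J_i'` are pairwise disjoint
and each of them is a connected subset of the Dynkin diagram. -/
def IsAlmostPolished {n : ℕ} (w : Equiv.Perm (Fin n)) : Prop :=
  ∃ (k : ℕ) (S J J' : Fin k → Set (Fin (n - 1))),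
    (∀ i j : Fin k, i ≠ j → Disjoint (S i) (S j)) ∧
    (∀ i : Fin k, ((dynkin n).induce (S i)).Connected) ∧
    (∀ i : Fin k, S i = J i ∪ J' i) ∧
    w = (List.ofFn fun i : Fin k => longest (J i) * longest (J i ∩ J' i) * longest (J' i)).prod

end BruhatGraph

/-!
The length of a permutation is its number of inversions, so `x → x (p q)` is an edge of the directed
Bruhat graph exactly when `p < q` and `x p < x q`. The Bruhat order enters through two facts: the
lifting property `le_mul_simple_iff`, and the monotonicity of the counts
`#{p < i | j ≤ x p}` (`Le.card_filter_le`), which certifies that a permutation is not below another.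

*Almost-polished permutations are vertex-transitive.* The lower interval of
`w₀(J) w₀(J ∩ J') w₀(J')` is `W_J W_J'` (`le_mul_mul_iff`), on which left multiplications by `W_J`
and right multiplications by `W_J'` act transitively by graph automorphisms. For factors with disjoint
supports, the lower interval of a product is the product of the lower intervals, and its Bruhat graph
is the Cartesian product of theirs (`adj_mul_iff`), since a reflection in `W_A W_B` lies in one of the
two subgroups. So transitivity passes to products (`IsHomogeneous.mul`).

*Vertex-transitive intervals avoid the patterns.* Two local properties of a vertex, invariant under
automorphisms, are compared at different vertices of the interval. Any two neighbours of the top `w`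
have a second common neighbour in the interval (`squaresClose_top`), but this fails at the vertex
obtained from `w` by sorting an occurrence of 3412 or 4231. An occurrence of 34521 or 54123 produces
three copies of `K_{3,3}` around an edge at `w`, which are independent in the sense of `HasWindmill`;
the bottom vertex never has such a configuration (`not_hasWindmill_one`), because two
transpositions which move a common position, both to the same side, lie in a common `K_{3,3}`.

*Permutations avoiding the patterns are almost-polished.* If for some `c` no position before `c`, or no
position after `c`, has its value on the other side of `c`, then `w` splits as a product of
permutations supported on `[a, c]` and `[c, b]`, which are again pattern-avoiding
(`exists_eq_mul_of_forall_le`); their sets of simple reflections are disjoint. Suppose now that there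
is no such `c`, and let `J` and `J'` index the left and right descents of `w`. The crucial point is a
combinatorial one about ascents (`IsInseparable.apply_le`, `IsInseparable.lt_apply`): for an ascent `t`
of `w` and an ascent `k` of `w⁻¹` with `t ≤ k`, all values at positions up to `t` are at most `k`, and
similarly for `k ≤ t`. Hence sorting the descending runs of `w` leaves an element of `W_J`, so
`w ∈ W_J W_J'`; as `W_J W_J'` lies below `w` because of the descents (`le_mul_of_descents`), `w` is its
maximum, namely `w₀(J) w₀(J ∩ J') w₀(J')` (`exists_eq_blockElement`).
-/

namespace BruhatGraph

open Equiv

/-! ### Length and inversions -/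

/-- The inversions of `w`, as pairs of positions. -/
def inversions {n : ℕ} (w : Perm (Fin n)) : Finset (Fin n × Fin n) :=
  Finset.univ.filter fun x => x.1 < x.2 ∧ w x.2 < w x.1

theorem mem_inversions {n : ℕ} {w : Perm (Fin n)} {x : Fin n × Fin n} :
    x ∈ inversions w ↔ x.1 < x.2 ∧ w x.2 < w x.1 := by
  simp [inversions]

/-- Inversions of `u` are moved by the transposition when this keeps the two positions in order,
and are inversions of `u * swap p q` as they stand otherwise. -/
theorem card_inversions_lt_mul_swap {n : ℕ} (u : Perm (Fin n)) {p q : Fin n} (hpq : p < q)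
    (h : u p < u q) : (inversions u).card < (inversions (u * swap p q)).card := by
  have hmem : (p, q) ∈ inversions (u * swap p q) := by
    simp [mem_inversions, hpq, h]
  refine lt_of_le_of_lt ?_ (Finset.card_erase_lt_of_mem hmem)
  let f : Fin n × Fin n → Fin n × Fin n := fun x =>
    if swap p q x.1 < swap p q x.2 then (swap p q x.1, swap p q x.2) else x
  refine Finset.card_le_card_of_injOn f ?_ ?_
  · rintro ⟨a, b⟩ hx
    simp only [Finset.mem_coe, mem_inversions] at hx
    obtain ⟨hab, hu⟩ := hx
    simp only [Finset.coe_erase, Set.mem_sdiff, Finset.mem_coe, Set.mem_singleton_iff]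
    by_cases hc : swap p q a < swap p q b
    · simp only [f, hc, if_true, mem_inversions, Perm.mul_apply, swap_apply_self]
      refine ⟨⟨trivial, hu⟩, fun he => ?_⟩
      rw [Prod.mk.injEq] at he
      have h1 : a = q := by rw [← swap_apply_self p q a, he.1, swap_apply_left]
      have h2 : b = p := by rw [← swap_apply_self p q b, he.2, swap_apply_right]
      subst h1 h2
      exact absurd hab (not_lt.mpr hpq.le)
    · simp only [f, hc, if_false, mem_inversions, Perm.mul_apply]
      refine ⟨⟨hab, ?_⟩, ?_⟩
      · rw [swap_apply_def, swap_apply_def] at hc ⊢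
        grind
      · rintro he
        rw [Prod.mk.injEq] at he
        rw [he.1, he.2] at hu
        exact absurd hu (not_lt.mpr h.le)
  · rintro ⟨a, b⟩ hx ⟨c, d⟩ hy hf
    simp only [Finset.mem_coe, mem_inversions] at hx hy
    by_cases h1 : swap p q a < swap p q b <;> by_cases h2 : swap p q c < swap p q d
    · simp only [f, h1, h2, if_true, Prod.mk.injEq, EmbeddingLike.apply_eq_iff_eq] at hf
      rw [hf.1, hf.2]
    · simp only [f, h1, h2, if_true, if_false, Prod.mk.injEq] at hf
      rw [← hf.1, ← hf.2, swap_apply_self, swap_apply_self] at h2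
      exact absurd hx.1 h2
    · simp only [f, h1, h2, if_true, if_false, Prod.mk.injEq] at hf
      rw [hf.1, hf.2, swap_apply_self, swap_apply_self] at h1
      exact absurd hy.1 h1
    · simpa only [f, h1, h2, if_false] using hf

theorem card_inversions_mul_simple_le {n : ℕ} (w : Perm (Fin n)) (i : Fin (n - 1)) :
    (inversions (w * simple n i)).card ≤ (inversions w).card + 1 := by
  set p : Fin n := ⟨i.val, by omega⟩ with hp
  set q : Fin n := ⟨i.val + 1, by omega⟩ with hq
  have hpv : p.val = i.val := rfl
  have hqv : q.val = i.val + 1 := rfl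
  have hs : simple n i = swap p q := rfl
  rw [hs]
  have h1 : ((inversions (w * swap p q)).erase (p, q)).card ≤ (inversions w).card := by
    refine Finset.card_le_card_of_injOn (fun x => (swap p q x.1, swap p q x.2)) ?_ ?_
    · rintro ⟨a, b⟩ hx
      simp only [Finset.coe_erase, Set.mem_sdiff, Finset.mem_coe, Set.mem_singleton_iff,
        mem_inversions, Perm.mul_apply, Prod.mk.injEq] at hx ⊢
      refine ⟨?_, hx.1.2⟩
      have h2 := hx.1.1
      have h3 := hx.2
      rw [swap_apply_def, swap_apply_def]
      simp only [Fin.ext_iff, Fin.lt_def] at *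
      split_ifs <;> omega
    · rintro ⟨a, b⟩ _ ⟨c, d⟩ _ hf
      simpa using hf
  have := Finset.pred_card_le_card_erase (s := inversions (w * swap p q)) (a := (p, q))
  omega

/-- A function which increases at each step of an interval of positions increases on it. -/
theorem lt_of_forall_step {n : ℕ} {α : Type*} [Preorder α] (f : Fin n → α) {p q : Fin n}
    (hpq : p < q)
    (h : ∀ (k : ℕ) (hk : k + 1 < n), p.val ≤ k → k < q.val →
      f ⟨k, by omega⟩ < f ⟨k + 1, hk⟩) : f p < f q := by
  obtain ⟨p, hp⟩ := p
  obtain ⟨q, hq⟩ := q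
  simp only [Fin.mk_lt_mk] at hpq
  induction q, hpq using Nat.le_induction with
  | base => exact h p hq le_rfl (Nat.lt_succ_self p)
  | succ m hm ih =>
    refine (ih (by omega) fun k hk h1 h2 => h k hk h1 (by simp only at h2 ⊢; omega)).trans ?_
    exact h m hq (by simp only; omega) (Nat.lt_succ_self m)

theorem eq_one_of_strictMono {n : ℕ} {w : Perm (Fin n)} (h : ∀ p q, p < q → w p < w q) :
    w = 1 := by
  have h1 : StrictMono w := fun p q hpq => h p q hpq
  have h2 := (StrictMono.range_inj h1 strictMono_id).mp (by simp)
  ext p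
  simp [h2]

/-- The position of the simple reflection `i`. -/
def pos {n : ℕ} (i : Fin (n - 1)) : Fin n := ⟨i.val, by omega⟩

/-- The position following that of the simple reflection `i`. -/
def pos' {n : ℕ} (i : Fin (n - 1)) : Fin n := ⟨i.val + 1, by omega⟩

theorem pos_lt_pos' {n : ℕ} (i : Fin (n - 1)) : pos i < pos' i := Nat.lt_succ_self _

theorem simple_eq_swap {n : ℕ} (i : Fin (n - 1)) : simple n i = swap (pos i) (pos' i) := rfl

theorem exists_descent {n : ℕ} {w : Perm (Fin n)} (hw : w ≠ 1) :
    ∃ i : Fin (n - 1), w (pos' i) < w (pos i) := by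
  by_contra! h
  refine hw (eq_one_of_strictMono fun p q hpq => lt_of_forall_step w hpq fun k hk _ _ => ?_)
  refine lt_of_le_of_ne (h ⟨k, by omega⟩) fun he => ?_
  simp at he

theorem card_inversions_lt_mul_swap' {n : ℕ} (u : Perm (Fin n)) {p q : Fin n} (hpq : p < q)
    (h : u q < u p) : (inversions (u * swap p q)).card < (inversions u).card := by
  have := card_inversions_lt_mul_swap (u * swap p q) hpq (by simpa using h)
  simpa [mul_assoc] using this

theorem length_le_of_wordProd {n : ℕ} (l : List (Fin (n - 1))) :
    length (wordProd n l) ≤ l.length := Nat.sInf_le ⟨l, rfl, rfl⟩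

theorem card_inversions_wordProd_le {n : ℕ} (l : List (Fin (n - 1))) :
    (inversions (wordProd n l)).card ≤ l.length := by
  induction l using List.reverseRecOn with
  | nil => simp [wordProd, inversions, Finset.filter_eq_empty_iff]; intros; omega
  | append_singleton l i ih =>
    have h := card_inversions_mul_simple_le (wordProd n l) i
    have h2 : wordProd n (l ++ [i]) = wordProd n l * simple n i := by simp [wordProd]
    rw [h2, List.length_append, List.length_singleton]
    omega

theorem exists_wordProd_length_le {n : ℕ} (w : Perm (Fin n)) :
    ∃ l : List (Fin (n - 1)), l.length ≤ (inversions w).card ∧ wordProd n l = w := by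
  induction hm : (inversions w).card using Nat.strong_induction_on generalizing w with
  | _ m ih =>
    by_cases hw : w = 1
    · exact ⟨[], by simp, by simp [wordProd, hw]⟩
    · obtain ⟨i, hi⟩ := exists_descent hw
      have hlt := card_inversions_lt_mul_swap' w (pos_lt_pos' i) hi
      obtain ⟨l, hl, hl'⟩ := ih _ (hm ▸ hlt) _ rfl
      refine ⟨l ++ [i], ?_, ?_⟩
      · rw [List.length_append, List.length_singleton]
        omega
      · have : wordProd n (l ++ [i]) = wordProd n l * simple n i := by simp [wordProd]
        rw [this, hl', simple_eq_swap, mul_assoc, swap_mul_self, mul_one]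

/-- The Coxeter length is the number of inversions. -/
theorem length_eq_card_inversions {n : ℕ} (w : Perm (Fin n)) :
    length w = (inversions w).card := by
  apply le_antisymm
  · obtain ⟨l, hl, rfl⟩ := exists_wordProd_length_le w
    exact (length_le_of_wordProd l).trans hl
  · obtain ⟨l, hl, hl'⟩ :=
      Nat.sInf_mem (s := {k : ℕ | ∃ l : List (Fin (n - 1)), l.length = k ∧ wordProd n l = w})
        (let ⟨l, hl⟩ := exists_wordProd w; ⟨l.length, l, rfl, hl⟩)
    have := card_inversions_wordProd_le l
    rw [hl', hl] at this
    exact this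

theorem length_lt_mul_swap_iff {n : ℕ} (u : Perm (Fin n)) {p q : Fin n} (hpq : p < q) :
    length u < length (u * swap p q) ↔ u p < u q := by
  rw [length_eq_card_inversions, length_eq_card_inversions]
  refine ⟨fun h => ?_, card_inversions_lt_mul_swap u hpq⟩
  by_contra h1
  have h2 : u q < u p := lt_of_le_of_ne (not_lt.mp h1) fun he => hpq.ne' (u.injective he)
  exact absurd (card_inversions_lt_mul_swap' u hpq h2) (not_lt.mpr h.le)

theorem length_inv {n : ℕ} (w : Perm (Fin n)) : length w⁻¹ = length w := by
  rw [length_eq_card_inversions, length_eq_card_inversions]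
  refine Finset.card_nbij' (fun x => (w⁻¹ x.2, w⁻¹ x.1)) (fun x => (w x.2, w x.1)) ?_ ?_ ?_ ?_ <;>
    intro x hx <;> simp_all [mem_inversions]

/-! ### Reflections and edges -/

theorem isReflection_iff {n : ℕ} {t : Perm (Fin n)} :
    IsReflection t ↔ ∃ p q, p < q ∧ t = swap p q := by
  constructor
  · rintro ⟨g, i, rfl⟩
    have h : g * simple n i * g⁻¹ = swap (g (pos i)) (g (pos' i)) := by
      rw [simple_eq_swap, swap_apply_apply]
    rcases lt_or_gt_of_ne (g.injective.ne (pos_lt_pos' i).ne) with h1 | h1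
    · exact ⟨_, _, h1, h⟩
    · exact ⟨_, _, h1, by rw [h, swap_comm]⟩
  · rintro ⟨p, q, hpq, rfl⟩
    have hp : p.val < n - 1 := by
      have := q.isLt
      have : p.val < q.val := hpq
      omega
    refine ⟨swap q (pos' ⟨p.val, hp⟩), ⟨p.val, hp⟩, ?_⟩
    rw [simple_eq_swap, ← swap_apply_apply, swap_apply_right]
    have h1 : (pos ⟨p.val, hp⟩ : Fin n) = p := rfl
    rw [h1, swap_apply_of_ne_of_ne hpq.ne]
    intro he
    have : p.val = p.val + 1 := congrArg Fin.val he
    omega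

theorem dirEdge_iff {n : ℕ} {u v : Perm (Fin n)} :
    DirEdge u v ↔ ∃ p q, p < q ∧ u p < u q ∧ v = u * swap p q := by
  constructor
  · rintro ⟨t, ht, rfl, hl⟩
    obtain ⟨p, q, hpq, rfl⟩ := isReflection_iff.mp ht
    exact ⟨p, q, hpq, (length_lt_mul_swap_iff u hpq).mp hl, rfl⟩
  · rintro ⟨p, q, hpq, hu, rfl⟩
    exact ⟨_, isReflection_iff.mpr ⟨p, q, hpq, rfl⟩, rfl,
      (length_lt_mul_swap_iff u hpq).mpr hu⟩

theorem isReflection_swap {n : ℕ} {p q : Fin n} (h : p ≠ q) : IsReflection (swap p q) := by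
  rcases lt_or_gt_of_ne h with h | h
  · exact isReflection_iff.mpr ⟨p, q, h, rfl⟩
  · exact isReflection_iff.mpr ⟨q, p, h, swap_comm _ _⟩

theorem bruhatGraph_adj {n : ℕ} {u v : Perm (Fin n)} :
    (bruhatGraph n).Adj u v ↔ ∃ p q, p ≠ q ∧ v = u * swap p q := by
  rw [bruhatGraph, SimpleGraph.fromRel_adj]
  constructor
  · rintro ⟨-, h | h⟩
    · obtain ⟨p, q, hpq, -, rfl⟩ := dirEdge_iff.mp h
      exact ⟨p, q, hpq.ne, rfl⟩
    · obtain ⟨p, q, hpq, -, rfl⟩ := dirEdge_iff.mp h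
      exact ⟨p, q, hpq.ne, by simp [mul_assoc]⟩
  · rintro ⟨p, q, hpq, rfl⟩
    wlog h : p < q generalizing p q
    · rw [swap_comm p q]
      exact this q p hpq.symm (lt_of_le_of_ne (not_lt.mp h) hpq.symm)
    refine ⟨fun he => ?_, ?_⟩
    · have h1 : swap p q = 1 := by
        have := he.symm
        rwa [mul_eq_left] at this
      exact hpq (swap_eq_one_iff.mp h1)
    · rcases lt_or_gt_of_ne (u.injective.ne hpq) with h1 | h1
      · exact Or.inl (dirEdge_iff.mpr ⟨p, q, h, h1, rfl⟩)
      · exact Or.inr (dirEdge_iff.mpr ⟨p, q, h, by simpa using h1, by simp [mul_assoc]⟩)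

/-! ### The Bruhat order -/

theorem Le.refl {n : ℕ} (u : Perm (Fin n)) : Le u u := Relation.ReflTransGen.refl

theorem Le.trans {n : ℕ} {u v w : Perm (Fin n)} (h : Le u v) (h' : Le v w) : Le u w :=
  Relation.ReflTransGen.trans h h'

theorem Le.length_le {n : ℕ} {u v : Perm (Fin n)} (h : Le u v) : length u ≤ length v := by
  induction h with
  | refl => exact le_rfl
  | tail _ h ih => obtain ⟨t, -, -, hl⟩ := h; omega

theorem Le.eq_of_length_le {n : ℕ} {u v : Perm (Fin n)} (h : Le u v)
    (hl : length v ≤ length u) : u = v := by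
  cases h with
  | refl => rfl
  | tail h1 h2 =>
    obtain ⟨t, -, -, hl'⟩ := h2
    have := Le.length_le h1
    omega

theorem Le.antisymm {n : ℕ} {u v : Perm (Fin n)} (h : Le u v) (h' : Le v u) : u = v :=
  h.eq_of_length_le h'.length_le

theorem le_mul_swap {n : ℕ} {u : Perm (Fin n)} {p q : Fin n} (hpq : p < q) (h : u p < u q) :
    Le u (u * swap p q) :=
  Relation.ReflTransGen.single (dirEdge_iff.mpr ⟨p, q, hpq, h, rfl⟩)

theorem mul_swap_le {n : ℕ} {u : Perm (Fin n)} {p q : Fin n} (hpq : p < q) (h : u q < u p) :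
    Le (u * swap p q) u :=
  Relation.ReflTransGen.single
    (dirEdge_iff.mpr ⟨p, q, hpq, by simpa using h, by simp [mul_assoc]⟩)

theorem one_le {n : ℕ} (w : Perm (Fin n)) : Le 1 w := by
  induction hm : (inversions w).card using Nat.strong_induction_on generalizing w with
  | _ m ih =>
    by_cases hw : w = 1
    · rw [hw]
      exact Le.refl 1
    · obtain ⟨i, hi⟩ := exists_descent hw
      exact (ih _ (hm ▸ card_inversions_lt_mul_swap' w (pos_lt_pos' i) hi) _ rfl).trans
        (mul_swap_le (pos_lt_pos' i) hi)

/-- The number of positions before `i` with value at least `j` increases in the Bruhat order. -/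
theorem Le.card_filter_le {n : ℕ} {u v : Perm (Fin n)} (h : Le u v) (i j : ℕ) :
    (Finset.univ.filter fun x : Fin n => x.val < i ∧ j ≤ (u x).val).card ≤
      (Finset.univ.filter fun x : Fin n => x.val < i ∧ j ≤ (v x).val).card := by
  induction h with
  | refl => exact le_rfl
  | @tail b c _ h ih =>
    refine ih.trans ?_
    obtain ⟨p, q, hpq, hu, rfl⟩ := dirEdge_iff.mp h
    refine Finset.card_le_card_of_injOn
      (fun x => if j ≤ (b p).val then x else swap p q x) ?_ ?_
    · intro x hx
      rw [Finset.mem_coe, Finset.mem_filter] at hx ⊢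
      simp only [Finset.mem_univ, true_and, Perm.mul_apply] at hx ⊢
      rw [Fin.lt_def] at hu hpq
      by_cases hj : j ≤ (b p).val
      · simp only [hj, if_true]
        rw [swap_apply_def]
        split_ifs with h1 h2
        · subst h1; omega
        · subst h2; omega
        · exact hx
      · simp only [hj, if_false, swap_apply_self]
        refine ⟨?_, hx.2⟩
        rw [swap_apply_def]
        split_ifs with h1 h2
        · subst h1; omega
        · subst h2; omega
        · exact hx.1
    · intro x _ y _ hxy
      by_cases hj : j ≤ (b p).val
      · simpa [hj] using hxy
      · simpa [hj] using hxy

/-- A criterion for `u` not to lie below `w`. -/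
theorem not_le_of_forall {n : ℕ} {u w : Perm (Fin n)} (i j : ℕ)
    (h : ∀ x : Fin n, x.val < i → j ≤ (w x).val → j ≤ (u x).val)
    (x₀ : Fin n) (h1 : x₀.val < i) (h2 : (w x₀).val < j) (h3 : j ≤ (u x₀).val) : ¬ Le u w := by
  intro hle
  refine absurd (hle.card_filter_le i j) (not_le.mpr (Finset.card_lt_card ?_))
  rw [Finset.ssubset_iff_of_subset]
  · exact ⟨x₀, by simp [h1, h3], by simp [h1, h2]⟩
  · intro x hx
    simp only [Finset.mem_filter, Finset.mem_univ, true_and] at hx ⊢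
    exact ⟨hx.1, h x hx.1 hx.2⟩

/-! ### Multiplication by a simple reflection -/

theorem simple_mul_self {n : ℕ} (i : Fin (n - 1)) : simple n i * simple n i = 1 := by
  rw [simple_eq_swap, swap_mul_self]

/-- Right multiplication by a simple reflection `s` maps every edge to an edge, except those
of the form `u → u s`. -/
theorem DirEdge.mul_simple {n : ℕ} {u v : Perm (Fin n)} (h : DirEdge u v) (i : Fin (n - 1)) :
    v = u * simple n i ∨ DirEdge (u * simple n i) (v * simple n i) := by
  obtain ⟨p, q, hpq, hu, rfl⟩ := dirEdge_iff.mp h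
  by_cases hp : p = pos i ∧ q = pos' i
  · left
    rw [hp.1, hp.2, simple_eq_swap]
  · right
    refine dirEdge_iff.mpr ⟨simple n i p, simple n i q, ?_, ?_, ?_⟩
    · rw [simple_eq_swap, swap_apply_def, swap_apply_def]
      simp only [pos, pos', Fin.ext_iff, Fin.lt_def] at *
      split_ifs <;> first | omega | (simp only; omega)
    · simpa [simple_eq_swap] using hu
    · rw [swap_apply_apply]
      simp [mul_assoc, simple_eq_swap]

theorem Le.mul_simple_or {n : ℕ} {x w : Perm (Fin n)} (h : Le x w) (i : Fin (n - 1)) :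
    Le (x * simple n i) w ∨ Le (x * simple n i) (w * simple n i) := by
  induction h using Relation.ReflTransGen.head_induction_on with
  | refl => exact Or.inr (Le.refl _)
  | head h1 h2 ih =>
    rcases h1.mul_simple i with h3 | h3
    · left
      rw [← h3]
      exact h2
    · rcases ih with h4 | h4
      · exact Or.inl (h4.head h3)
      · exact Or.inr (h4.head h3)

/-- The lifting property of the Bruhat order. -/
theorem le_mul_simple_iff {n : ℕ} {x w : Perm (Fin n)} {i : Fin (n - 1)}
    (hi : w (pos i) < w (pos' i)) :
    Le x (w * simple n i) ↔ Le x w ∨ Le (x * simple n i) w := by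
  have hw : Le w (w * simple n i) := le_mul_swap (pos_lt_pos' i) hi
  constructor
  · intro h
    induction h using Relation.ReflTransGen.head_induction_on with
    | refl =>
      right
      rw [mul_assoc, simple_mul_self, mul_one]
      exact Le.refl w
    | head h1 h2 ih =>
      rcases ih with h3 | h3
      · exact Or.inl (h3.head h1)
      · rcases h1.mul_simple i with h4 | h4
        · left
          rw [h4, mul_assoc, simple_mul_self, mul_one] at h3
          exact h3
        · exact Or.inr (h3.head h4)
  · rintro (h | h)
    · exact h.trans hw
    · have := h.mul_simple_or i
      rw [mul_assoc, simple_mul_self, mul_one] at this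
      rcases this with h | h
      · exact h.trans hw
      · exact h

theorem apply_inv_apply {α : Type*} (w : Perm α) (p : α) : w (w⁻¹ p) = p := w.apply_symm_apply p

theorem inv_apply_apply {α : Type*} (w : Perm α) (p : α) : w⁻¹ (w p) = p := w.symm_apply_apply p

/-! ### Parabolic subgroups as block stabilizers -/

/-- The parabolic subgroup of the simple reflections with index in `J`, described by blocks: a
permutation belongs to it when it preserves every initial segment `{0, …, k}` with `k ∉ J`, that is,
when it preserves the blocks of positions into which the elements of the complement of `J` cut
`Fin n`. Indices `k ≥ n - 1` impose no condition. -/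
def blockStabilizer (n : ℕ) (J : Set ℕ) : Subgroup (Perm (Fin n)) where
  carrier := {x | ∀ k ∉ J, ∀ p : Fin n, p.val ≤ k → (x p).val ≤ k}
  mul_mem' {x y} hx hy k hk p hp := hx k hk _ (hy k hk p hp)
  one_mem' k _ p hp := hp
  inv_mem' {x} hx k hk p hp := by
    have := Perm.perm_symm_on_of_perm_on_finite (f := x) (p := fun p : Fin n => p.val ≤ k)
      (fun p hp => hx k hk p hp) hp
    exact this

/-- Two positions `p ≤ q` lie in the same block of `J`. -/
def SameBlock {n : ℕ} (J : Set ℕ) (p q : Fin n) : Prop :=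
  ∀ k, p.val ≤ k → k < q.val → k ∈ J

theorem apply_le_iff {n : ℕ} {J : Set ℕ} {x : Perm (Fin n)} (hx : x ∈ blockStabilizer n J) {k : ℕ}
    (hk : k ∉ J) (p : Fin n) : (x p).val ≤ k ↔ p.val ≤ k := by
  refine ⟨fun h => ?_, hx k hk p⟩
  have := (blockStabilizer n J).inv_mem hx k hk _ h
  simpa using this

theorem blockStabilizer_mono {n : ℕ} {J K : Set ℕ} (h : J ⊆ K) :
    blockStabilizer n J ≤ blockStabilizer n K :=
  fun _ hx k hk => hx k fun hk' => hk (h hk')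

/-- An inversion of a block-preserving permutation lies within one block. -/
theorem sameBlock_of_inversion {n : ℕ} {J : Set ℕ} {x : Perm (Fin n)}
    (hx : x ∈ blockStabilizer n J) {p q : Fin n} (h : x q < x p) : SameBlock J p q := by
  intro k h1 h2
  by_contra hk
  have h3 := (apply_le_iff hx hk p).mpr h1
  have h4 := (apply_le_iff hx hk q).not.mpr (not_le.mpr h2)
  rw [Fin.lt_def] at h
  omega

theorem sameBlock_apply {n : ℕ} {J : Set ℕ} {x : Perm (Fin n)}
    (hx : x ∈ blockStabilizer n J) (p : Fin n) : SameBlock J p (x p) ∧ SameBlock J (x p) p := by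
  refine ⟨fun k h1 h2 => ?_, fun k h1 h2 => ?_⟩ <;> by_contra hk <;>
    have := apply_le_iff hx hk p <;> omega

theorem SameBlock.eq_of_disjoint {n : ℕ} {A B : Set ℕ} (hAB : Disjoint A B) {p q : Fin n}
    (hA : SameBlock A p q ∧ SameBlock A q p) (hB : SameBlock B p q ∧ SameBlock B q p) :
    p = q := by
  rw [Set.disjoint_left] at hAB
  rcases lt_trichotomy p.val q.val with h | h | h
  · exact absurd (hB.1 _ le_rfl h) (hAB (hA.1 _ le_rfl h))
  · exact Fin.ext h
  · exact absurd (hB.2 _ le_rfl h) (hAB (hA.2 _ le_rfl h))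

theorem SameBlock.symm_trans {n : ℕ} {A : Set ℕ} {p q r : Fin n}
    (h : SameBlock A p q ∧ SameBlock A q p) (h' : SameBlock A q r ∧ SameBlock A r q) :
    SameBlock A p r ∧ SameBlock A r p := by
  refine ⟨fun k h1 h2 => ?_, fun k h1 h2 => ?_⟩
  · rcases lt_or_ge k q.val with h3 | h3
    · exact h.1 k h1 h3
    · exact h'.1 k h3 h2
  · rcases lt_or_ge k q.val with h3 | h3
    · exact h'.2 k h1 h3
    · exact h.2 k h3 h2

theorem eq_one_of_mem_of_mem {n : ℕ} {A B : Set ℕ} (hAB : Disjoint A B) {x : Perm (Fin n)}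
    (hA : x ∈ blockStabilizer n A) (hB : x ∈ blockStabilizer n B) : x = 1 := by
  ext p
  rw [← SameBlock.eq_of_disjoint hAB (sameBlock_apply hA p) (sameBlock_apply hB p)]
  rfl

/-- If `a` and `b` lie in parabolic subgroups with disjoint supports and `a b` is a reflection,
then one of them is trivial: a position fixed by `a b` and its image under `b` lie in the same block
for both supports, so that `b` moves at most the two positions which the reflection exchanges. -/
theorem eq_one_or_eq_one_of_isReflection {n : ℕ} {A B : Set ℕ} (hAB : Disjoint A B)
    {a b : Perm (Fin n)} (ha : a ∈ blockStabilizer n A) (hb : b ∈ blockStabilizer n B)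
    (h : IsReflection (a * b)) : a = 1 ∨ b = 1 := by
  obtain ⟨p, q, hpq, hab⟩ := isReflection_iff.mp h
  have hfix : ∀ r, r ≠ p → r ≠ q → b r = r := by
    intro r hp hq
    have h1 : a (b r) = r := by
      rw [← Perm.mul_apply, hab, swap_apply_of_ne_of_ne hp hq]
    have h2 := sameBlock_apply ha (b r)
    rw [h1] at h2
    exact SameBlock.eq_of_disjoint hAB h2 (sameBlock_apply hb r).symm
  by_cases hbp : b p = p
  · right
    have hbq : b q = q := by
      by_contra hbq
      have h1 : b (b q) ≠ b q := b.injective.ne hbq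
      by_cases h2 : b q = p
      · rw [h2] at h1
        exact h1 hbp
      · exact h1 (hfix _ h2 hbq)
    ext r
    by_cases hp : r = p
    · rw [hp, hbp, Perm.one_apply]
    · by_cases hq : r = q
      · rw [hq, hbq, Perm.one_apply]
      · rw [hfix r hp hq, Perm.one_apply]
  · left
    have h1 : b p = q := by
      by_contra h1
      exact b.injective.ne hbp (hfix _ hbp h1)
    have h2 : b q = p := by
      by_contra h2
      have h3 : b q ≠ q := fun h3 => hpq.ne (b.injective (h1.trans h3.symm))
      exact b.injective.ne h3 (hfix _ h2 h3)
    have h3 : b = swap p q := by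
      ext r
      by_cases hp : r = p
      · rw [hp, h1, swap_apply_left]
      · by_cases hq : r = q
        · rw [hq, h2, swap_apply_right]
        · rw [hfix r hp hq, swap_apply_of_ne_of_ne hp hq]
    rw [← h3] at hab
    exact mul_eq_right.mp hab

theorem Le.mem_blockStabilizer {n : ℕ} {J : Set ℕ} {x y : Perm (Fin n)} (h : Le y x)
    (hx : x ∈ blockStabilizer n J) : y ∈ blockStabilizer n J := by
  intro k hk p hp
  by_contra hy
  refine not_le_of_forall (k + 1) (k + 1) (fun r hr hr' => ?_) p (by omega) ?_ (by omega) h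
  · have := hx k hk r (by omega)
    omega
  · have := hx k hk p hp
    omega

/-! ### The longest element of a parabolic subgroup -/

/-- The permutation `z` reverses each of the blocks of `J`. -/
def IsReversal {n : ℕ} (J : Set ℕ) (z : Perm (Fin n)) : Prop :=
  z ∈ blockStabilizer n J ∧ ∀ p q : Fin n, p < q → SameBlock J p q → z q < z p

theorem isReversal_of_forall_descent {n : ℕ} {J : Set ℕ} {z : Perm (Fin n)}
    (hz : z ∈ blockStabilizer n J)
    (h : ∀ k ∈ J, ∀ hk : k + 1 < n, z ⟨k + 1, hk⟩ < z ⟨k, by omega⟩) : IsReversal J z := by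
  refine ⟨hz, fun p q hpq hb => ?_⟩
  exact lt_of_forall_step (fun p => OrderDual.toDual (z p)) hpq
    fun k hk h1 h2 => h k (hb k h1 h2) hk

theorem IsReversal.unique {n : ℕ} {J : Set ℕ} {y z : Perm (Fin n)} (hy : IsReversal J y)
    (hz : IsReversal J z) : y = z := by
  have key : y⁻¹ * z = 1 := by
    refine eq_one_of_strictMono fun p q hpq => ?_
    by_contra hlt
    have hne : (y⁻¹ * z) q < (y⁻¹ * z) p :=
      lt_of_le_of_ne (not_lt.mp hlt) fun he => hpq.ne' ((y⁻¹ * z).injective he)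
    have hmem := (blockStabilizer n J).mul_mem ((blockStabilizer n J).inv_mem hy.1) hz.1
    have hb := sameBlock_of_inversion hmem hne
    have h1 := hz.2 p q hpq hb
    have hb' : SameBlock J ((y⁻¹ * z) q) ((y⁻¹ * z) p) := by
      have e1 := sameBlock_apply hmem p
      have e2 := sameBlock_apply hmem q
      have e3 : SameBlock J p q ∧ SameBlock J q p := by
        refine ⟨hb, fun k h1 h2 => ?_⟩
        rw [Fin.lt_def] at hpq
        omega
      exact (SameBlock.symm_trans e2.symm (SameBlock.symm_trans e3.symm e1)).1
    have h2 := hy.2 _ _ hne hb'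
    simp only [Perm.mul_apply, apply_inv_apply] at h2
    exact absurd h1 (not_lt.mpr h2.le)
  exact inv_mul_eq_one.mp key

theorem IsReversal.inv {n : ℕ} {J : Set ℕ} {z : Perm (Fin n)} (hz : IsReversal J z) :
    IsReversal J z⁻¹ := by
  have hmem := (blockStabilizer n J).inv_mem hz.1
  refine ⟨hmem, fun p q hpq hb => ?_⟩
  by_contra hlt
  have hne : z⁻¹ p < z⁻¹ q :=
    lt_of_le_of_ne (not_lt.mp hlt) fun he => hpq.ne (z⁻¹.injective he)
  have e3 : SameBlock J p q ∧ SameBlock J q p := by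
    refine ⟨hb, fun k h1 h2 => ?_⟩
    rw [Fin.lt_def] at hpq
    omega
  have hb' := (SameBlock.symm_trans (sameBlock_apply hmem p).symm
    (SameBlock.symm_trans e3 (sameBlock_apply hmem q))).1
  have := hz.2 _ _ hne hb'
  rw [apply_inv_apply, apply_inv_apply] at this
  exact absurd this (not_lt.mpr hpq.le)

theorem IsReversal.inv_eq {n : ℕ} {J : Set ℕ} {z : Perm (Fin n)} (hz : IsReversal J z) :
    z⁻¹ = z := hz.inv.unique hz

theorem parabolic_le_blockStabilizer {n : ℕ} (J : Set (Fin (n - 1))) :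
    parabolic J ≤ blockStabilizer n (Fin.val '' J) := by
  rw [parabolic, Subgroup.closure_le]
  rintro _ ⟨i, hi, rfl⟩ k hk p hp
  have hik : i.val ≠ k := fun h => hk ⟨i, hi, h⟩
  rw [simple_eq_swap, swap_apply_def]
  split_ifs with h1 h2
  · subst h1
    simp only [pos, pos'] at *
    omega
  · subst h2
    simp only [pos, pos'] at *
    omega
  · exact hp

theorem isReversal_longest {n : ℕ} (J : Set (Fin (n - 1))) :
    IsReversal (Fin.val '' J) (longest J) := by
  have hmem : longest J ∈ parabolic J := (exists_longest J).choose_spec.1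
  have hmax : ∀ y ∈ parabolic J, length y ≤ length (longest J) :=
    (exists_longest J).choose_spec.2
  refine isReversal_of_forall_descent (parabolic_le_blockStabilizer J hmem) ?_
  rintro _ ⟨i, hi, rfl⟩ hk
  have h1 := hmax (longest J * simple n i) ((parabolic J).mul_mem hmem
    (Subgroup.subset_closure ⟨i, hi, rfl⟩))
  rw [simple_eq_swap] at h1
  have h2 := (length_lt_mul_swap_iff (longest J) (pos_lt_pos' i)).not.mp (not_lt.mpr h1)
  exact lt_of_le_of_ne (not_lt.mp h2) fun he =>
    (pos_lt_pos' i).ne ((longest J).injective he).symm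

theorem card_inversions_le {n : ℕ} (w : Perm (Fin n)) : (inversions w).card ≤ n * n := by
  refine (Finset.card_le_univ _).trans ?_
  simp

theorem mul_simple_mem {n : ℕ} {J : Set ℕ} {y : Perm (Fin n)} (hy : y ∈ blockStabilizer n J)
    {i : Fin (n - 1)} (hi : i.val ∈ J) : y * simple n i ∈ blockStabilizer n J := by
  refine (blockStabilizer n J).mul_mem hy (blockStabilizer_mono (J := Fin.val '' {i}) ?_
    (parabolic_le_blockStabilizer {i} (Subgroup.subset_closure ⟨i, rfl, rfl⟩)))
  rintro _ ⟨j, rfl, rfl⟩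
  exact hi

theorem IsReversal.le_of_mem {n : ℕ} {J : Set ℕ} {z : Perm (Fin n)} (hz : IsReversal J z)
    {y : Perm (Fin n)} (hy : y ∈ blockStabilizer n J) : Le y z := by
  induction hm : n * n - (inversions y).card using Nat.strong_induction_on generalizing y with
  | _ m ih =>
    by_cases h : ∀ k ∈ J, ∀ hk : k + 1 < n, y ⟨k + 1, hk⟩ < y ⟨k, by omega⟩
    · rw [(isReversal_of_forall_descent hy h).unique hz]
      exact Le.refl z
    · push Not at h
      obtain ⟨k, hkJ, hk, hle⟩ := h
      let i : Fin (n - 1) := ⟨k, by omega⟩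
      have hlt : y (pos i) < y (pos' i) := lt_of_le_of_ne hle fun he =>
        (pos_lt_pos' i).ne (y.injective he)
      have h1 := card_inversions_lt_mul_swap y (pos_lt_pos' i) hlt
      have h2 := card_inversions_le (y * swap (pos i) (pos' i))
      exact (le_mul_swap (pos_lt_pos' i) hlt).trans
        (ih _ (by omega) (mul_simple_mem (i := i) hy hkJ) rfl)

theorem IsReversal.le_iff {n : ℕ} {J : Set ℕ} {z : Perm (Fin n)} (hz : IsReversal J z)
    {y : Perm (Fin n)} : Le y z ↔ y ∈ blockStabilizer n J :=
  ⟨fun h => h.mem_blockStabilizer hz.1, hz.le_of_mem⟩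

/-! ### Lower intervals of length-additive products -/

/-- If no inversion of `v⁻¹` is an inversion of `u`, so that `ℓ (u v) = ℓ u + ℓ v`, then the lower
interval of `u v` is the product of those of `u` and `v`. -/
theorem le_mul_iff {n : ℕ} {u v : Perm (Fin n)}
    (h : ∀ i j, i < j → v j < v i → u (v j) < u (v i)) {x : Perm (Fin n)} :
    Le x (u * v) ↔ ∃ a b, Le a u ∧ Le b v ∧ x = a * b := by
  induction hm : (inversions v).card using Nat.strong_induction_on generalizing v x with
  | _ m ih =>
    by_cases hv : v = 1
    · subst hv
      constructor
      · intro hx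
        exact ⟨x, 1, by simpa using hx, Le.refl 1, by simp⟩
      · rintro ⟨a, b, ha, hb, rfl⟩
        rw [hb.antisymm (one_le b), mul_one, mul_one]
        exact ha
    · obtain ⟨i, hi⟩ := exists_descent hv
      obtain ⟨v', rfl⟩ : ∃ v', v = v' * simple n i :=
        ⟨v * simple n i, by rw [mul_assoc, simple_mul_self, mul_one]⟩
      have hlt := card_inversions_lt_mul_swap' _ (pos_lt_pos' i) hi
      rw [← simple_eq_swap, mul_assoc, simple_mul_self, mul_one] at hlt
      have hi' : v' (pos i) < v' (pos' i) := by simpa [simple_eq_swap] using hi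
      have hui : (u * v') (pos i) < (u * v') (pos' i) := by
        have := h _ _ (pos_lt_pos' i) hi
        simpa [simple_eq_swap] using this
      have hadd : ∀ p q, p < q → v' q < v' p → u (v' q) < u (v' p) := by
        intro p q hpq hv'
        have h1 := h (simple n i p) (simple n i q) ?_ (by simpa [simple_eq_swap] using hv')
        · simpa [simple_eq_swap] using h1
        · have hne : ¬ (p = pos i ∧ q = pos' i) := by
            rintro ⟨rfl, rfl⟩
            exact absurd hv' (not_lt.mpr hi'.le)
          rw [simple_eq_swap, swap_apply_def, swap_apply_def]
          simp only [pos, pos', Fin.ext_iff, Fin.lt_def] at *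
          split_ifs <;> first | omega | (simp only; omega)
      rw [← mul_assoc, le_mul_simple_iff hui, ih _ (hm ▸ hlt) hadd rfl,
        ih _ (hm ▸ hlt) hadd rfl]
      constructor
      · rintro (⟨a, b, ha, hb, rfl⟩ | ⟨a, b, ha, hb, hx⟩)
        · exact ⟨a, b, ha, (le_mul_simple_iff hi').mpr (Or.inl hb), rfl⟩
        · refine ⟨a, b * simple n i, ha, (le_mul_simple_iff hi').mpr (Or.inr ?_), ?_⟩
          · rwa [mul_assoc, simple_mul_self, mul_one]
          · rw [← mul_assoc, ← hx, mul_assoc, simple_mul_self, mul_one]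
      · rintro ⟨a, b, ha, hb, rfl⟩
        rcases (le_mul_simple_iff hi').mp hb with hb | hb
        · exact Or.inl ⟨a, b, ha, hb, rfl⟩
        · exact Or.inr ⟨a, _, ha, hb, mul_assoc _ _ _⟩

theorem le_mul_iff_of_disjoint {n : ℕ} {A B : Set ℕ} (hAB : Disjoint A B) {u v : Perm (Fin n)}
    (hu : u ∈ blockStabilizer n A) (hv : v ∈ blockStabilizer n B) {x : Perm (Fin n)} :
    Le x (u * v) ↔ ∃ a b, Le a u ∧ Le b v ∧ x = a * b := by
  refine le_mul_iff fun i j hij hlt => ?_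
  by_contra hle
  have hlt' : u (v i) < u (v j) :=
    lt_of_le_of_ne (not_lt.mp hle) fun he => hlt.ne' (u.injective he)
  have h1 := sameBlock_of_inversion hu hlt'
  have h2 : SameBlock B (v j) (v i) := by
    refine sameBlock_of_inversion (x := v⁻¹) ((blockStabilizer n B).inv_mem hv) ?_
    simpa using hij
  exact Set.disjoint_left.mp hAB (h1 _ le_rfl hlt) (h2 _ le_rfl hlt)

/-- The lower interval of `w₀(A) w₀(A ∩ B) w₀(B)` is `W_A W_B`. -/
theorem le_mul_mul_iff {n : ℕ} {A B : Set ℕ} {a b c : Perm (Fin n)} (ha : IsReversal A a)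
    (hc : IsReversal (A ∩ B) c) (hb : IsReversal B b) {x : Perm (Fin n)} :
    Le x (a * c * b) ↔
      ∃ y z, y ∈ blockStabilizer n A ∧ z ∈ blockStabilizer n B ∧ x = y * z := by
  have hcB : c ∈ blockStabilizer n B := blockStabilizer_mono Set.inter_subset_right hc.1
  have hcb := (blockStabilizer n B).mul_mem hcB hb.1
  -- An inversion of `(c b)⁻¹ = b c` lies in a block of `B` but not in a block of `A`.
  have key : ∀ i j, i < j → (c * b) j < (c * b) i → ¬ SameBlock A ((c * b) j) ((c * b) i) := by
    intro i j hij hlt hA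
    have hB : SameBlock B ((c * b) j) ((c * b) i) := by
      refine sameBlock_of_inversion (x := (c * b)⁻¹) ((blockStabilizer n B).inv_mem hcb) ?_
      simpa using hij
    have h1 := hc.2 _ _ hlt fun k h1 h2 => ⟨hA k h1 h2, hB k h1 h2⟩
    have hcc : ∀ p, c (c p) = p := fun p => by
      nth_rewrite 1 [← hc.inv_eq]
      exact inv_apply_apply c p
    rw [Perm.mul_apply, Perm.mul_apply, hcc, hcc] at h1
    have hB' : SameBlock B (b i) (b j) := by
      refine sameBlock_of_inversion (x := c) hcB ?_
      exact hlt
    have h2 := hb.inv.2 _ _ h1 hB'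
    simp only [inv_apply_apply] at h2
    exact absurd hij (not_lt.mpr h2.le)
  have key2 : ∀ {C : Set ℕ} {d : Perm (Fin n)}, C ⊆ A → IsReversal C d → ∀ i j, i < j →
      (c * b) j < (c * b) i → d ((c * b) j) < d ((c * b) i) := by
    intro C d hC hd i j hij hlt
    by_contra hle
    refine key i j hij hlt fun k h1 h2 => hC (sameBlock_of_inversion hd.1
      (lt_of_le_of_ne (not_lt.mp hle) fun he => hlt.ne' (d.injective he)) k h1 h2)
  have hbcb : ∀ y, y ∈ blockStabilizer n B ↔
      ∃ p q, p ∈ blockStabilizer n (A ∩ B) ∧ Le q (c * b) ∧ y = p * q := by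
    intro y
    have h1 : c * (c * b) = b := by
      nth_rewrite 1 [← hc.inv_eq]
      exact inv_mul_cancel_left c b
    rw [← hb.le_iff]
    nth_rewrite 1 [← h1]
    rw [le_mul_iff (key2 Set.inter_subset_left hc)]
    simp only [hc.le_iff]
  rw [mul_assoc, le_mul_iff (key2 subset_rfl ha)]
  simp only [ha.le_iff]
  constructor
  · rintro ⟨p, q, hp, hq, rfl⟩
    exact ⟨p, q, hp, hq.mem_blockStabilizer hcb, rfl⟩
  · rintro ⟨y, z, hy, hz, rfl⟩
    obtain ⟨p, q, hp, hq, rfl⟩ := (hbcb z).mp hz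
    exact ⟨y * p, q, (blockStabilizer n A).mul_mem hy
      (blockStabilizer_mono Set.inter_subset_left hp), hq, (mul_assoc _ _ _).symm⟩

/-! ### Transitivity of automorphism groups -/

theorem bruhatGraph_adj_iff {n : ℕ} {u v : Perm (Fin n)} :
    (bruhatGraph n).Adj u v ↔ IsReflection (u⁻¹ * v) := by
  rw [bruhatGraph_adj]
  constructor
  · rintro ⟨p, q, hpq, rfl⟩
    rw [inv_mul_cancel_left]
    exact isReflection_swap hpq
  · intro h
    obtain ⟨p, q, hpq, h⟩ := isReflection_iff.mp h
    exact ⟨p, q, hpq.ne, by rw [← h, mul_inv_cancel_left]⟩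

theorem IsReflection.conj {n : ℕ} {t : Perm (Fin n)} (h : IsReflection t) (g : Perm (Fin n)) :
    IsReflection (g * t * g⁻¹) := by
  obtain ⟨k, i, rfl⟩ := h
  exact ⟨g * k, i, by group⟩

theorem isReflection_conj_iff {n : ℕ} {t : Perm (Fin n)} (g : Perm (Fin n)) :
    IsReflection (g * t * g⁻¹) ↔ IsReflection t := by
  refine ⟨fun h => ?_, fun h => h.conj g⟩
  have := h.conj g⁻¹
  simpa [mul_assoc] using this

/-- A set `X` of permutations is homogeneous when for each `x ∈ X` there is an automorphism of the
subgraph of the Bruhat graph induced on `X` which maps the identity to `x`. The set `X` being finite,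
it is enough for an automorphism that it be injective. -/
def IsHomogeneous {n : ℕ} (X : Set (Perm (Fin n))) : Prop :=
  ∀ x ∈ X, ∃ f : Perm (Fin n) → Perm (Fin n), Set.MapsTo f X X ∧ Set.InjOn f X ∧ f 1 = x ∧
    ∀ y ∈ X, ∀ z ∈ X, (bruhatGraph n).Adj (f y) (f z) ↔ (bruhatGraph n).Adj y z

theorem IsHomogeneous.isVertexTransitive {n : ℕ} {X : Set (Perm (Fin n))} (h : IsHomogeneous X)
    (h1 : (1 : Perm (Fin n)) ∈ X) : IsVertexTransitive ((bruhatGraph n).induce X) := by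
  have key : ∀ x : X, ∃ φ : (bruhatGraph n).induce X ≃g (bruhatGraph n).induce X,
      φ ⟨1, h1⟩ = x := by
    rintro ⟨x, hx⟩
    obtain ⟨f, hf, hinj, hf1, hadj⟩ := h x hx
    have hb : Function.Bijective (hf.restrict f X X) :=
      Finite.injective_iff_bijective.mp fun y z hyz =>
        Subtype.ext (hinj y.2 z.2 (congrArg Subtype.val hyz))
    exact ⟨⟨Equiv.ofBijective _ hb, fun {y z} => hadj y y.2 z z.2⟩, Subtype.ext hf1⟩
  intro x y
  obtain ⟨φ, hφ⟩ := key x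
  obtain ⟨ψ, hψ⟩ := key y
  refine ⟨φ.symm.trans ψ, ?_⟩
  rw [← hφ, ← hψ]
  simp

/-- The Bruhat graph is invariant under left and right multiplications, and those by elements of `H`
and of `K` act transitively on `H K`. -/
theorem isHomogeneous_mul {n : ℕ} (H K : Subgroup (Perm (Fin n))) :
    IsHomogeneous {x | ∃ a b, a ∈ H ∧ b ∈ K ∧ x = a * b} := by
  rintro _ ⟨a, b, ha, hb, rfl⟩
  refine ⟨fun y => a * y * b, ?_, ?_, by simp, ?_⟩
  · rintro _ ⟨c, d, hc, hd, rfl⟩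
    exact ⟨a * c, d * b, H.mul_mem ha hc, K.mul_mem hd hb, by simp only [mul_assoc]⟩
  · intro y _ z _ hyz
    simpa using hyz
  · intro y _ z _
    rw [bruhatGraph_adj_iff, bruhatGraph_adj_iff, ← isReflection_conj_iff b⁻¹ (t := y⁻¹ * z)]
    have : (a * y * b)⁻¹ * (a * z * b) = b⁻¹ * (y⁻¹ * z) * b⁻¹⁻¹ := by group
    rw [this]

/-- For factors in parabolic subgroups with disjoint supports, the Bruhat graph on a product set
is the Cartesian product of the Bruhat graphs on the factors. -/
theorem adj_mul_iff {n : ℕ} {A B : Set ℕ} (hAB : Disjoint A B) {a b c d : Perm (Fin n)}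
    (ha : a ∈ blockStabilizer n A) (hc : c ∈ blockStabilizer n A)
    (hb : b ∈ blockStabilizer n B) (hd : d ∈ blockStabilizer n B) :
    (bruhatGraph n).Adj (a * b) (c * d) ↔
      (a = c ∧ (bruhatGraph n).Adj b d) ∨ (b = d ∧ (bruhatGraph n).Adj a c) := by
  simp only [bruhatGraph_adj_iff]
  have e1 : (a * b)⁻¹ * (c * d) = b⁻¹ * ((a⁻¹ * c) * (d * b⁻¹)) * b⁻¹⁻¹ := by group
  have e2 : b⁻¹ * d = b⁻¹ * (d * b⁻¹) * b⁻¹⁻¹ := by group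
  rw [e1, isReflection_conj_iff, e2, isReflection_conj_iff]
  constructor
  · intro h
    have hac := (blockStabilizer n A).mul_mem ((blockStabilizer n A).inv_mem ha) hc
    have hdb := (blockStabilizer n B).mul_mem hd ((blockStabilizer n B).inv_mem hb)
    rcases eq_one_or_eq_one_of_isReflection hAB hac hdb h with h1 | h1
    · rw [h1, one_mul] at h
      exact Or.inl ⟨inv_mul_eq_one.mp h1, h⟩
    · rw [h1, mul_one] at h
      exact Or.inr ⟨(mul_inv_eq_one.mp h1).symm, h⟩
  · rintro (⟨rfl, h⟩ | ⟨rfl, h⟩)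
    · rwa [inv_mul_cancel, one_mul]
    · rwa [mul_inv_cancel, mul_one]

theorem mul_eq_mul_iff_of_disjoint {n : ℕ} {A B : Set ℕ} (hAB : Disjoint A B)
    {a b c d : Perm (Fin n)} (ha : a ∈ blockStabilizer n A) (hc : c ∈ blockStabilizer n A)
    (hb : b ∈ blockStabilizer n B) (hd : d ∈ blockStabilizer n B) :
    a * b = c * d ↔ a = c ∧ b = d := by
  refine ⟨fun h => ?_, fun h => by rw [h.1, h.2]⟩
  have h1 : c⁻¹ * a = d * b⁻¹ := by
    rw [inv_mul_eq_iff_eq_mul, ← mul_assoc, ← h, mul_inv_cancel_right]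
  have h2 : c⁻¹ * a = 1 := eq_one_of_mem_of_mem hAB
    ((blockStabilizer n A).mul_mem ((blockStabilizer n A).inv_mem hc) ha)
    (h1 ▸ (blockStabilizer n B).mul_mem hd ((blockStabilizer n B).inv_mem hb))
  rw [h2] at h1
  exact ⟨(inv_mul_eq_one.mp h2).symm, (mul_inv_eq_one.mp h1.symm).symm⟩

theorem IsHomogeneous.mul {n : ℕ} {A B : Set ℕ} (hAB : Disjoint A B) {X Y : Set (Perm (Fin n))}
    (hX : IsHomogeneous X) (hY : IsHomogeneous Y) (hXA : X ⊆ blockStabilizer n A)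
    (hYB : Y ⊆ blockStabilizer n B) (hX1 : 1 ∈ X) (hY1 : 1 ∈ Y) :
    IsHomogeneous {x | ∃ a b, a ∈ X ∧ b ∈ Y ∧ x = a * b} := by
  classical
  rintro _ ⟨a, b, ha, hb, rfl⟩
  obtain ⟨f, hf, hfi, hf1, hfa⟩ := hX a ha
  obtain ⟨g, hg, hgi, hg1, hga⟩ := hY b hb
  let F : Perm (Fin n) → Perm (Fin n) := fun y =>
    if h : ∃ c d, c ∈ X ∧ d ∈ Y ∧ y = c * d then f h.choose * g h.choose_spec.choose else y
  have hF : ∀ c ∈ X, ∀ d ∈ Y, F (c * d) = f c * g d := by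
    intro c hc d hd
    have h : ∃ c' d', c' ∈ X ∧ d' ∈ Y ∧ c * d = c' * d' := ⟨c, d, hc, hd, rfl⟩
    obtain ⟨h1, h2, h3⟩ := h.choose_spec.choose_spec
    obtain ⟨h4, h5⟩ := (mul_eq_mul_iff_of_disjoint hAB (hXA hc) (hXA h1) (hYB hd) (hYB h2)).mp h3
    simp only [F, dif_pos h]
    exact congrArg₂ (· * ·) (congrArg f h4.symm) (congrArg g h5.symm)
  refine ⟨F, ?_, ?_, ?_, ?_⟩
  · rintro _ ⟨c, d, hc, hd, rfl⟩
    exact ⟨f c, g d, hf hc, hg hd, hF c hc d hd⟩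
  · rintro _ ⟨c, d, hc, hd, rfl⟩ _ ⟨c', d', hc', hd', rfl⟩ h
    rw [hF c hc d hd, hF c' hc' d' hd', mul_eq_mul_iff_of_disjoint hAB (hXA (hf hc))
      (hXA (hf hc')) (hYB (hg hd)) (hYB (hg hd'))] at h
    rw [hfi hc hc' h.1, hgi hd hd' h.2]
  · have := hF 1 hX1 1 hY1
    rwa [mul_one, hf1, hg1] at this
  · rintro _ ⟨c, d, hc, hd, rfl⟩ _ ⟨c', d', hc', hd', rfl⟩
    rw [hF c hc d hd, hF c' hc' d' hd', adj_mul_iff hAB (hXA (hf hc))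
      (hXA (hf hc')) (hYB (hg hd)) (hYB (hg hd')), adj_mul_iff hAB (hXA hc)
      (hXA hc') (hYB hd) (hYB hd'), hfa c hc c' hc', hga d hd d' hd', hfi.eq_iff hc hc',
      hgi.eq_iff hd hd']

/-! ### Products of maximal elements of double cosets -/

/-- The element `w₀(J) w₀(J ∩ J') w₀(J')` for `x = (J, J')`. -/
noncomputable def blockElement {n : ℕ} (x : Set (Fin (n - 1)) × Set (Fin (n - 1))) :
    Perm (Fin n) :=
  longest x.1 * longest (x.1 ∩ x.2) * longest x.2

/-- The positions of the simple reflections in `J ∪ J'`, for `x = (J, J')`. -/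
def blockSupport {n : ℕ} (x : Set (Fin (n - 1)) × Set (Fin (n - 1))) : Set ℕ :=
  Fin.val '' (x.1 ∪ x.2)

theorem isReversal_longest_inter {n : ℕ} (J K : Set (Fin (n - 1))) :
    IsReversal (Fin.val '' J ∩ Fin.val '' K) (longest (J ∩ K)) := by
  rw [← Set.image_inter Fin.val_injective]
  exact isReversal_longest _

theorem blockElement_mem {n : ℕ} (x : Set (Fin (n - 1)) × Set (Fin (n - 1))) :
    blockElement x ∈ blockStabilizer n (blockSupport x) := by
  refine Subgroup.mul_mem _ (Subgroup.mul_mem _ ?_ ?_) ?_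
  · exact blockStabilizer_mono (Set.image_mono Set.subset_union_left) (isReversal_longest _).1
  · exact blockStabilizer_mono (Set.image_mono (Set.inter_subset_left.trans
      Set.subset_union_left)) (isReversal_longest _).1
  · exact blockStabilizer_mono (Set.image_mono Set.subset_union_right) (isReversal_longest _).1

theorem isHomogeneous_le_blockElement {n : ℕ} (x : Set (Fin (n - 1)) × Set (Fin (n - 1))) :
    IsHomogeneous {y : Perm (Fin n) | Le y (blockElement x)} := by
  have h := isHomogeneous_mul (blockStabilizer n (Fin.val '' x.1))
    (blockStabilizer n (Fin.val '' x.2))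
  convert h using 1
  ext y
  exact le_mul_mul_iff (isReversal_longest _) (isReversal_longest_inter _ _)
    (isReversal_longest _)

theorem isHomogeneous_le_prod {n : ℕ} (l : List (Set (Fin (n - 1)) × Set (Fin (n - 1))))
    (hl : l.Pairwise fun x y => Disjoint (blockSupport x) (blockSupport y)) :
    IsHomogeneous {y : Perm (Fin n) | Le y (l.map blockElement).prod} ∧
      (l.map blockElement).prod ∈ blockStabilizer n (⋃ x ∈ l, blockSupport x) := by
  induction l with
  | nil =>
    refine ⟨?_, Subgroup.one_mem _⟩
    intro x hx
    obtain rfl : x = 1 := Le.antisymm hx (one_le x)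
    exact ⟨id, Set.mapsTo_id _, Set.injOn_id _, rfl, fun _ _ _ _ => Iff.rfl⟩
  | cons x l ih =>
    obtain ⟨h1, h2⟩ := List.pairwise_cons.mp hl
    obtain ⟨h3, h4⟩ := ih h2
    have hd : Disjoint (blockSupport x) (⋃ y ∈ l, blockSupport y) := by
      simpa only [Set.disjoint_iUnion_right] using h1
    rw [List.map_cons, List.prod_cons]
    constructor
    · have := (isHomogeneous_le_blockElement x).mul hd h3
        (fun y hy => Le.mem_blockStabilizer hy (blockElement_mem x))
        (fun y hy => Le.mem_blockStabilizer hy h4) (one_le _) (one_le _)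
      convert this using 1
      ext y
      exact le_mul_iff_of_disjoint hd (blockElement_mem x) h4
    · refine Subgroup.mul_mem _ (blockStabilizer_mono ?_ (blockElement_mem x))
        (blockStabilizer_mono ?_ h4)
      · exact Set.subset_biUnion_of_mem (u := fun y => blockSupport y) List.mem_cons_self
      · exact Set.biUnion_mono (fun y hy => List.mem_cons_of_mem x hy) fun _ _ => subset_rfl

theorem interval_one_eq {n : ℕ} (w : Perm (Fin n)) : interval 1 w = {x | Le x w} :=
  Set.ext fun x => ⟨fun h => h.2, fun h => ⟨one_le x, h⟩⟩

theorem IsAlmostPolished.isVertexTransitive {n : ℕ} {w : Perm (Fin n)}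
    (h : IsAlmostPolished w) : IsVertexTransitive (intervalGraph 1 w) := by
  obtain ⟨k, S, J, J', hS, -, hJ, rfl⟩ := h
  have h1 := isHomogeneous_le_prod (List.ofFn fun i => (J i, J' i)) <| by
    rw [List.pairwise_ofFn]
    intro i j hij
    rw [blockSupport, blockSupport, Set.disjoint_image_iff Fin.val_injective]
    simp only
    rw [← hJ, ← hJ]
    exact hS i j hij.ne
  rw [List.map_ofFn] at h1
  rw [intervalGraph, interval_one_eq]
  exact h1.1.isVertexTransitive (one_le _)

/-! ### Common neighbours in the Bruhat graph -/

theorem swap_mul_swap_comm {α : Type*} [DecidableEq α] {a b c d : α} (hac : a ≠ c) (had : a ≠ d)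
    (hbc : b ≠ c) (hbd : b ≠ d) : swap a b * swap c d = swap c d * swap a b := by
  ext x
  simp only [Perm.mul_apply, swap_apply_def]
  grind

theorem swap_mul_swap_eq {α : Type*} [DecidableEq α] {a b c : α} (hab : a ≠ b)
    (hbc : b ≠ c) : swap a b * swap a c = swap a c * swap b c := by
  ext x
  simp only [Perm.mul_apply, swap_apply_def]
  grind

theorem swap_mul_swap_eq' {α : Type*} [DecidableEq α] {a b c : α} (hab : a ≠ b)
    (hbc : b ≠ c) : swap a c * swap a b = swap b c * swap a c := by
  ext x
  simp only [Perm.mul_apply, swap_apply_def]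
  grind

theorem eq_or_eq_of_swap_mul_eq_aux {α : Type*} [DecidableEq α] {p q e f x y : α}
    (hpq : p ≠ q) (hef : e ≠ f) (hpe : p ≠ e)
    (hs : ∀ r, swap x y r = swap p e (swap p q (swap e f r))) (h2 : swap p q ≠ swap p e) :
    swap p e = swap e f ∨ swap p q * swap e f = swap p e * swap p q := by
  have hqe : q ≠ e := by rintro rfl; exact h2 rfl
  by_cases h3 : p = f
  · subst h3
    exact Or.inl (swap_comm _ _)
  by_cases h4 : q = f
  · subst h4
    right
    ext z
    simp only [Perm.mul_apply, swap_apply_def]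
    grind
  · exfalso
    have h5 := hs f
    have h6 := hs p
    simp only [swap_apply_def] at h5 h6
    grind

/-- If `t s = t' s'` for transpositions with `t ≠ t'` and `t ≠ s`, then `t'` is one of `s` and
`t s t`. -/
theorem eq_or_eq_of_swap_mul_eq {α : Type*} [DecidableEq α] {p q e f i j x y : α}
    (hpq : p ≠ q) (hef : e ≠ f) (hij : i ≠ j)
    (h : swap p q * swap e f = swap i j * swap x y)
    (h1 : swap p q ≠ swap e f) (h2 : swap p q ≠ swap i j) :
    swap i j = swap e f ∨ swap p q * swap e f = swap i j * swap p q := by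
  have hs : ∀ r, swap x y r = swap i j (swap p q (swap e f r)) := by
    intro r
    have := congrArg (fun g : Perm α => swap i j (g r)) h
    simpa using this.symm
  -- Both `i` and `j` are moved by the product, hence belong to `{p, q, e, f}`.
  have hmove : ∀ i j : α, i ≠ j → (∀ r, swap x y r = swap i j (swap p q (swap e f r))) →
      i = p ∨ i = q ∨ i = e ∨ i = f := by
    intro i j hij hs
    by_contra hne
    push Not at hne
    obtain ⟨n1, n2, n3, n4⟩ := hne
    have h3 : swap x y i = j := by
      rw [hs, swap_apply_of_ne_of_ne n3 n4, swap_apply_of_ne_of_ne n1 n2, swap_apply_left]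
    have h4 : swap x y = swap i j := by
      ext z
      simp only [swap_apply_def] at h3 ⊢
      grind
    apply h1
    ext z
    have h5 := hs (swap e f z)
    rw [h4] at h5
    simpa using h5.symm
  have hi := hmove i j hij hs
  have hj := hmove j i hij.symm (by simpa only [swap_comm j i] using hs)
  have hcross : (i = p ∨ i = q) → (j = e ∨ j = f) →
      swap i j = swap e f ∨ swap p q * swap e f = swap i j * swap p q := by
    rintro (rfl | rfl) (rfl | rfl)
    · exact eq_or_eq_of_swap_mul_eq_aux hpq hef hij hs h2
    · rw [swap_comm e j] at hs ⊢
      exact eq_or_eq_of_swap_mul_eq_aux hpq hef.symm hij hs h2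
    · rw [swap_comm p i] at hs h2 ⊢
      exact eq_or_eq_of_swap_mul_eq_aux hpq.symm hef hij hs h2
    · rw [swap_comm p i] at hs h2 ⊢
      rw [swap_comm e j] at hs ⊢
      exact eq_or_eq_of_swap_mul_eq_aux hpq.symm hef.symm hij hs h2
  have hcross' : (j = p ∨ j = q) → (i = e ∨ i = f) →
      swap i j = swap e f ∨ swap p q * swap e f = swap i j * swap p q := by
    rw [swap_comm i j] at hs h2 ⊢
    rintro (rfl | rfl) (rfl | rfl)
    · exact eq_or_eq_of_swap_mul_eq_aux hpq hef hij.symm hs h2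
    · rw [swap_comm e i] at hs ⊢
      exact eq_or_eq_of_swap_mul_eq_aux hpq hef.symm hij.symm hs h2
    · rw [swap_comm p j] at hs h2 ⊢
      exact eq_or_eq_of_swap_mul_eq_aux hpq.symm hef hij.symm hs h2
    · rw [swap_comm p j] at hs h2 ⊢
      rw [swap_comm e i] at hs ⊢
      exact eq_or_eq_of_swap_mul_eq_aux hpq.symm hef.symm hij.symm hs h2
  have hin : (i = p ∨ i = q) → (j = p ∨ j = q) → False := by
    rintro (rfl | rfl) (rfl | rfl)
    exacts [hij rfl, h2 rfl, h2 (swap_comm _ _), hij rfl]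
  have hout : (i = e ∨ i = f) → (j = e ∨ j = f) → swap i j = swap e f := by
    rintro (rfl | rfl) (rfl | rfl)
    exacts [absurd rfl hij, rfl, swap_comm _ _, absurd rfl hij]
  rw [← or_assoc] at hi hj
  rcases hi with hi | hi <;> rcases hj with hj | hj
  · exact (hin hi hj).elim
  · exact hcross hi hj
  · exact hcross' hj hi
  · exact Or.inl (hout hi hj)

/-- The common neighbours of two distinct neighbours `v t` and `v t'` of `v` in the Bruhat graph
are `v`, `v t t'` and `v t' t`. -/
theorem common_neighbor {n : ℕ} {v u : Perm (Fin n)} {p q p' q' : Fin n} (hpq : p ≠ q)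
    (hpq' : p' ≠ q') (hne : swap p q ≠ swap p' q') (huv : u ≠ v)
    (h1 : (bruhatGraph n).Adj (v * swap p q) u) (h2 : (bruhatGraph n).Adj (v * swap p' q') u) :
    u = v * swap p q * swap p' q' ∨ u = v * swap p' q' * swap p q := by
  obtain ⟨e, f, hef, rfl⟩ := bruhatGraph_adj.mp h1
  obtain ⟨x, y, -, h⟩ := bruhatGraph_adj.mp h2
  rw [mul_assoc, mul_assoc, mul_right_inj] at h
  have hne' : swap p q ≠ swap e f := by
    intro he
    rw [← he, mul_assoc, swap_mul_self, mul_one] at huv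
    exact huv rfl
  rcases eq_or_eq_of_swap_mul_eq hpq hef hpq' h hne' hne with h3 | h3
  · left
    rw [h3]
  · right
    rw [mul_assoc, h3, mul_assoc]

theorem adj_mul_swap {n : ℕ} (v : Perm (Fin n)) {p q : Fin n} (hpq : p ≠ q) :
    (bruhatGraph n).Adj v (v * swap p q) := bruhatGraph_adj.mpr ⟨p, q, hpq, rfl⟩

theorem adj_mul_swap_mul {n : ℕ} (v g : Perm (Fin n)) {p q : Fin n} (hpq : p ≠ q) :
    (bruhatGraph n).Adj (v * g) (v * swap p q * g) := by
  rw [bruhatGraph_adj_iff]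
  have : (v * g)⁻¹ * (v * swap p q * g) = g⁻¹ * swap p q * g⁻¹⁻¹ := by group
  rw [this, isReflection_conj_iff]
  exact isReflection_swap hpq

/-! ### An obstruction from the patterns 3412 and 4231 -/

/-- Any two distinct neighbours of `v` have a common neighbour besides `v`. -/
def SquaresClose {V : Type*} (G : SimpleGraph V) (v : V) : Prop :=
  ∀ y z, G.Adj v y → G.Adj v z → y ≠ z → ∃ u, u ≠ v ∧ G.Adj y u ∧ G.Adj z u

theorem SquaresClose.map {V : Type*} {G : SimpleGraph V} {v : V} (h : SquaresClose G v)
    (φ : G ≃g G) : SquaresClose G (φ v) := by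
  intro y z hy hz hyz
  obtain ⟨u, hu, h1, h2⟩ := h (φ.symm y) (φ.symm z)
    (by rw [← φ.map_adj_iff]; simpa using hy) (by rw [← φ.map_adj_iff]; simpa using hz)
    (φ.symm.injective.ne hyz)
  refine ⟨φ u, φ.injective.ne hu, ?_, ?_⟩
  · rw [← φ.map_adj_iff] at h1; simpa using h1
  · rw [← φ.map_adj_iff] at h2; simpa using h2

/-- The vertex `x` of the interval `[1, w]`. -/
def vertex {n : ℕ} {w : Perm (Fin n)} (x : Perm (Fin n)) (h : Le x w) : interval 1 w :=
  ⟨x, one_le x, h⟩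

theorem exists_inversion_of_adj {n : ℕ} {w y : Perm (Fin n)} (hy : Le y w)
    (h : (bruhatGraph n).Adj w y) : ∃ p q, p < q ∧ w q < w p ∧ y = w * swap p q := by
  obtain ⟨p, q, hpq, rfl⟩ := bruhatGraph_adj.mp h
  wlog hlt : p < q generalizing p q
  · rw [swap_comm p q] at hy h ⊢
    exact this q p hpq.symm hy h (lt_of_le_of_ne (not_lt.mp hlt) hpq.symm)
  refine ⟨p, q, hlt, ?_, rfl⟩
  have h1 := (length_lt_mul_swap_iff w hlt).not.mp (not_lt.mpr hy.length_le)
  exact lt_of_le_of_ne (not_lt.mp h1) (w.injective.ne hpq.symm)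

theorem squaresClose_top {n : ℕ} (w : Perm (Fin n)) :
    SquaresClose (intervalGraph 1 w) (vertex w (Le.refl w)) := by
  rintro ⟨y, _, hy⟩ ⟨z, _, hz⟩ hwy hwz hyz
  obtain ⟨p, q, hpq, h1, rfl⟩ := exists_inversion_of_adj hy hwy
  obtain ⟨p', q', hpq', h1', rfl⟩ := exists_inversion_of_adj hz hwz
  have hne : swap p q ≠ swap p' q' := fun h => hyz (Subtype.ext (by simp only [h]))
  have key : w (swap p q q') < w (swap p q p') ∨ w (swap p' q' q) < w (swap p' q' p) := by
    have hne' : ¬ (p = p' ∧ q = q') := by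
      rintro ⟨rfl, rfl⟩
      exact hne rfl
    have hinj : ∀ a b, a ≠ b → w a ≠ w b := fun a b h => w.injective.ne h
    simp only [swap_apply_def]
    grind
  have hmul : swap p q * swap p' q' ≠ 1 := by
    rw [Ne, mul_eq_one_iff_eq_inv, swap_inv]
    exact hne
  have hmul' : swap p' q' * swap p q ≠ 1 := by
    rw [Ne, mul_eq_one_iff_eq_inv, swap_inv]
    exact hne.symm
  rcases key with h | h
  · refine ⟨vertex (w * swap p q * swap p' q') ((mul_swap_le hpq' h).trans hy), ?_,
      adj_mul_swap _ hpq'.ne, adj_mul_swap_mul _ _ hpq.ne⟩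
    intro he
    have := congrArg Subtype.val he
    simp only [vertex, mul_assoc, mul_eq_left] at this
    exact hmul this
  · refine ⟨vertex (w * swap p' q' * swap p q) ((mul_swap_le hpq h).trans hz), ?_,
      adj_mul_swap_mul _ _ hpq'.ne, adj_mul_swap _ hpq.ne⟩
    intro he
    have := congrArg Subtype.val he
    simp only [vertex, mul_assoc, mul_eq_left] at this
    exact hmul' this

theorem not_squaresClose {n : ℕ} {w x : Perm (Fin n)} {p q p' q' : Fin n} (hpq : p ≠ q)
    (hpq' : p' ≠ q') (hne : swap p q ≠ swap p' q') (hx : Le x w) (h1 : Le (x * swap p q) w)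
    (h2 : Le (x * swap p' q') w) (h3 : ¬ Le (x * swap p q * swap p' q') w)
    (h4 : ¬ Le (x * swap p' q' * swap p q) w) :
    ¬ SquaresClose (intervalGraph 1 w) (vertex x hx) := by
  intro h
  obtain ⟨⟨u, _, hu⟩, hux, hu1, hu2⟩ := h (vertex _ h1) (vertex _ h2) (adj_mul_swap _ hpq)
    (adj_mul_swap _ hpq') (fun he => hne (by
      have := congrArg Subtype.val he
      simpa [vertex] using this))
  have hux' : u ≠ x := fun he => hux (Subtype.ext he)
  rcases common_neighbor hpq hpq' hne hux' hu1 hu2 with rfl | rfl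
  · exact h3 hu
  · exact h4 hu

theorem mul_swap_apply {n : ℕ} (w : Perm (Fin n)) (p q r : Fin n) :
    (w * swap p q) r = if r = p then w q else if r = q then w p else w r := by
  rw [Perm.mul_apply, swap_apply_def]
  split_ifs <;> rfl

theorem IsVertexTransitive.squaresClose {n : ℕ} {w : Perm (Fin n)}
    (h : IsVertexTransitive (intervalGraph 1 w)) (x : interval 1 w) :
    SquaresClose (intervalGraph 1 w) x := by
  obtain ⟨φ, rfl⟩ := h (vertex w (Le.refl w)) x
  exact (squaresClose_top w).map φ

theorem swap_ne_swap {α : Type*} [DecidableEq α] {a b c d : α} (hab : a ≠ b) (hac : a ≠ c)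
    (had : a ≠ d) : swap a b ≠ swap c d := by
  intro h
  have := congrArg (fun g : Perm α => g a) h
  simp only [swap_apply_left, swap_apply_of_ne_of_ne hac had] at this
  exact hab this.symm

/-- When `w` has the pattern 4231 at four positions, sort it there to `1234`: the neighbours `3214`
and `1432` lie in the interval, but `3412` does not. -/
theorem not_isVertexTransitive_of_4231 {n : ℕ} {w : Perm (Fin n)} {a b c d : Fin n} (hab : a < b)
    (hbc : b < c) (hcd : c < d) (h1 : w d < w b) (h2 : w b < w c) (h3 : w c < w a) :
    ¬ IsVertexTransitive (intervalGraph 1 w) := by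
  intro h
  have hac := hab.trans hbc
  have hbd := hbc.trans hcd
  have had := hac.trans hcd
  have hx : Le (w * swap a d) w := mul_swap_le had (h1.trans (h2.trans h3))
  have hy : w * swap a d * swap a c = w * swap c d * swap a d := by
    rw [mul_assoc, mul_assoc, swap_mul_swap_eq' hac.ne hcd.ne]
  have hz : w * swap a d * swap b d = w * swap a b * swap a d := by
    rw [mul_assoc, mul_assoc, swap_mul_swap_eq hab.ne hbd.ne]
  have hnle : ¬ Le (w * swap a d * swap a c * swap b d) w := by
    refine not_le_of_forall c.val (w c).val (fun r hr hr' => ?_) b hbc h2 ?_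
    · simp only [mul_swap_apply]
      grind
    · simp only [mul_swap_apply]
      grind
  refine not_squaresClose (p := a) (q := c) (p' := b) (q' := d) hac.ne hbd.ne
    (swap_ne_swap hac.ne hab.ne had.ne) hx ?_ ?_ hnle ?_ (h.squaresClose _)
  · rw [hy]
    refine (mul_swap_le had ?_).trans (mul_swap_le hcd (h1.trans h2))
    simp only [mul_swap_apply]
    grind
  · rw [hz]
    refine (mul_swap_le had ?_).trans (mul_swap_le hab (h2.trans h3))
    simp only [mul_swap_apply]
    grind
  · convert hnle using 1
    simp only [mul_assoc]
    rw [swap_mul_swap_comm hab.ne had.ne hbc.ne' hcd.ne]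

/-- When `w` has the pattern 3412 at four positions, sort it there to `1234`: the neighbours `3214`
and `1243` lie in the interval, but neither `3241` nor `4213` does. -/
theorem not_isVertexTransitive_of_3412 {n : ℕ} {w : Perm (Fin n)} {a b c d : Fin n} (hab : a < b)
    (hbc : b < c) (hcd : c < d) (h1 : w c < w d) (h2 : w d < w a) (h3 : w a < w b) :
    ¬ IsVertexTransitive (intervalGraph 1 w) := by
  intro h
  have hac := hab.trans hbc
  have hbd := hbc.trans hcd
  have had := hac.trans hcd
  have hx1 : Le (w * swap a c) w := mul_swap_le hac (h1.trans h2)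
  have hx2 : Le (w * swap b d) w := mul_swap_le hbd (h2.trans h3)
  have hx : Le (w * swap b d * swap a c) w := by
    refine (mul_swap_le hac ?_).trans hx2
    simp only [mul_swap_apply]
    grind
  have hz : w * swap b d * swap a c * swap c d = w * swap b c * swap a b * swap b d := by
    ext r
    simp only [mul_swap_apply]
    grind
  refine not_squaresClose (p := a) (q := c) (p' := c) (q' := d) hac.ne hcd.ne
    (swap_ne_swap hac.ne hac.ne had.ne) hx ?_ ?_ ?_ ?_ (h.squaresClose _)
  · rwa [mul_assoc, swap_mul_self, mul_one]
  · rw [hz]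
    refine ((mul_swap_le hbd ?_).trans (mul_swap_le hab ?_)).trans
      (mul_swap_le hbc (h1.trans (h2.trans h3))) <;>
    · simp only [mul_swap_apply]
      grind
  · refine not_le_of_forall d.val (w d).val (fun r hr hr' => ?_) c hcd h1 ?_ <;>
    · simp only [mul_swap_apply]
      grind
  · refine not_le_of_forall b.val (w b).val (fun r hr hr' => ?_) a hab h3 ?_ <;>
    · simp only [mul_swap_apply]
      grind

/-! ### An obstruction from the patterns 34521 and 54123 -/

/-- The vertices `y` and `z` have two common neighbours besides `v`. -/
def HasTwoCommon {V : Type*} (G : SimpleGraph V) (v y z : V) : Prop :=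
  ∃ u₁ u₂, u₁ ≠ u₂ ∧ u₁ ≠ v ∧ u₂ ≠ v ∧ (G.Adj y u₁ ∧ G.Adj z u₁) ∧ (G.Adj y u₂ ∧ G.Adj z u₂)

/-- There are three subgraphs `K_{3,3}` sharing an edge `v y`, the blades, with parts `{v, u₁, u₂}`
and `{y, z i, z' i}`, such that no two neighbours of `v` other than `y` which belong to different
blades have two common neighbours besides `v`. -/
def HasWindmill {V : Type*} (G : SimpleGraph V) (v : V) : Prop :=
  ∃ (y : V) (z z' : Fin 3 → V), G.Adj v y ∧ (∀ i, G.Adj v (z i) ∧ G.Adj v (z' i) ∧ y ≠ z i ∧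
      y ≠ z' i ∧ z i ≠ z' i ∧ ∃ u₁ u₂, u₁ ≠ u₂ ∧ u₁ ≠ v ∧ u₂ ≠ v ∧
        (G.Adj y u₁ ∧ G.Adj (z i) u₁ ∧ G.Adj (z' i) u₁) ∧
        (G.Adj y u₂ ∧ G.Adj (z i) u₂ ∧ G.Adj (z' i) u₂)) ∧
    ∀ i j, i ≠ j → ¬ HasTwoCommon G v (z i) (z j) ∧ ¬ HasTwoCommon G v (z i) (z' j) ∧
      ¬ HasTwoCommon G v (z' i) (z' j)

theorem HasTwoCommon.symm {V : Type*} {G : SimpleGraph V} {v y z : V} (h : HasTwoCommon G v y z) :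
    HasTwoCommon G v z y := by
  obtain ⟨u₁, u₂, h1, h2, h3, h4, h5⟩ := h
  exact ⟨u₁, u₂, h1, h2, h3, h4.symm, h5.symm⟩

theorem hasTwoCommon_map_iff {V : Type*} {G : SimpleGraph V} {v y z : V} (φ : G ≃g G) :
    HasTwoCommon G (φ v) (φ y) (φ z) ↔ HasTwoCommon G v y z := by
  constructor
  · rintro ⟨u₁, u₂, h⟩
    obtain ⟨u₁, rfl⟩ := φ.surjective u₁
    obtain ⟨u₂, rfl⟩ := φ.surjective u₂
    refine ⟨u₁, u₂, ?_⟩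
    simpa only [φ.map_adj_iff, ne_eq, φ.injective.eq_iff] using h
  · rintro ⟨u₁, u₂, h⟩
    refine ⟨φ u₁, φ u₂, ?_⟩
    simpa only [φ.map_adj_iff, ne_eq, φ.injective.eq_iff] using h

theorem HasWindmill.map {V : Type*} {G : SimpleGraph V} {v : V} (h : HasWindmill G v)
    (φ : G ≃g G) : HasWindmill G (φ v) := by
  obtain ⟨y, z, z', hy, hz, hzz⟩ := h
  refine ⟨φ y, φ ∘ z, φ ∘ z', φ.map_adj_iff.mpr hy, fun i => ?_, fun i j hij => ?_⟩
  · obtain ⟨h1, h2, h3, h4, h5, u₁, u₂, h6⟩ := hz i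
    simp only [Function.comp_apply, φ.map_adj_iff, ne_eq, φ.injective.eq_iff]
    refine ⟨h1, h2, h3, h4, h5, φ u₁, φ u₂, ?_⟩
    simpa only [φ.map_adj_iff, ne_eq, φ.injective.eq_iff] using h6
  · simpa only [Function.comp_apply, hasTwoCommon_map_iff] using hzz i j hij

/-- If `v t` and `v t'` have two common neighbours besides `v`, these are `v t t'` and `v t' t`. -/
theorem eq_and_eq_of_two_common {n : ℕ} {v u₁ u₂ : Perm (Fin n)} {p q p' q' : Fin n} (hpq : p ≠ q)
    (hpq' : p' ≠ q') (hne : swap p q ≠ swap p' q') (hu : u₁ ≠ u₂) (h₁ : u₁ ≠ v) (h₂ : u₂ ≠ v)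
    (h1 : (bruhatGraph n).Adj (v * swap p q) u₁ ∧ (bruhatGraph n).Adj (v * swap p' q') u₁)
    (h2 : (bruhatGraph n).Adj (v * swap p q) u₂ ∧ (bruhatGraph n).Adj (v * swap p' q') u₂) :
    (u₁ = v * swap p q * swap p' q' ∧ u₂ = v * swap p' q' * swap p q) ∨
      (u₁ = v * swap p' q' * swap p q ∧ u₂ = v * swap p q * swap p' q') := by
  rcases common_neighbor hpq hpq' hne h₁ h1.1 h1.2 with e1 | e1 <;>
    rcases common_neighbor hpq hpq' hne h₂ h2.1 h2.2 with e2 | e2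
  · exact absurd (e1.trans e2.symm) hu
  · exact Or.inl ⟨e1, e2⟩
  · exact Or.inr ⟨e1, e2⟩
  · exact absurd (e1.trans e2.symm) hu

theorem HasTwoCommon.le_and_le {n : ℕ} {w : Perm (Fin n)} {v y z : interval 1 w}
    (h : HasTwoCommon (intervalGraph 1 w) v y z) {p q p' q' : Fin n} (hpq : p ≠ q)
    (hpq' : p' ≠ q') (hne : swap p q ≠ swap p' q') (hy : y.val = v.val * swap p q)
    (hz : z.val = v.val * swap p' q') :
    Le (v.val * swap p q * swap p' q') w ∧ Le (v.val * swap p' q' * swap p q) w ∧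
      swap p q * swap p' q' ≠ swap p' q' * swap p q := by
  obtain ⟨u₁, u₂, h1, h2, h3, ⟨h4, h4'⟩, ⟨h5, h5'⟩⟩ := h
  have a1 : (bruhatGraph n).Adj y.val u₁.val := h4
  have a2 : (bruhatGraph n).Adj z.val u₁.val := h4'
  have a3 : (bruhatGraph n).Adj y.val u₂.val := h5
  have a4 : (bruhatGraph n).Adj z.val u₂.val := h5'
  rw [hy] at a1 a3
  rw [hz] at a2 a4
  have hu : u₁.val ≠ u₂.val := fun he => h1 (Subtype.ext he)
  have key := eq_and_eq_of_two_common hpq hpq' hne hu (fun he => h2 (Subtype.ext he))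
    (fun he => h3 (Subtype.ext he)) ⟨a1, a2⟩ ⟨a3, a4⟩
  rcases key with ⟨e1, e2⟩ | ⟨e1, e2⟩
  · refine ⟨e1 ▸ u₁.2.2, e2 ▸ u₂.2.2, fun hc => hu ?_⟩
    rw [e1, e2, mul_assoc, mul_assoc, hc]
  · refine ⟨e2 ▸ u₂.2.2, e1 ▸ u₁.2.2, fun hc => hu ?_⟩
    rw [e1, e2, mul_assoc, mul_assoc, hc]

/-! ### The bottom of the interval has no windmill -/

/-- If `y` is the transposition `(p q)` and the edges from `1` to `y`, `z`, `z'` span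
a `K_{3,3}`, then `z` and `z'` are the transpositions `(p r)` and `(q r)` for some `r`. -/
theorem exists_third_position {n : ℕ} {w : Perm (Fin n)} {p q : Fin n} (hpq : p ≠ q)
    {v y z z' : interval 1 w} (hv : v.val = 1) (hy : y.val = swap p q)
    (hz : (intervalGraph 1 w).Adj v z) (hz' : (intervalGraph 1 w).Adj v z') (hyz : y ≠ z)
    (hyz' : y ≠ z') (hzz : z ≠ z')
    (h : ∃ u₁ u₂, u₁ ≠ u₂ ∧ u₁ ≠ v ∧ u₂ ≠ v ∧
        ((intervalGraph 1 w).Adj y u₁ ∧ (intervalGraph 1 w).Adj z u₁ ∧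
          (intervalGraph 1 w).Adj z' u₁) ∧
        ((intervalGraph 1 w).Adj y u₂ ∧ (intervalGraph 1 w).Adj z u₂ ∧
          (intervalGraph 1 w).Adj z' u₂)) :
    ∃ r, r ≠ p ∧ r ≠ q ∧ ((z.val = swap p r ∧ z'.val = swap q r) ∨
      (z.val = swap q r ∧ z'.val = swap p r)) := by
  obtain ⟨u₁, u₂, hu, hu1, hu2, ⟨a1, b1, c1⟩, ⟨a2, b2, c2⟩⟩ := h
  obtain ⟨e, f, hef, hze⟩ := bruhatGraph_adj.mp (show (bruhatGraph n).Adj v.val z.val from hz)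
  obtain ⟨i, j, hij, hzi⟩ := bruhatGraph_adj.mp (show (bruhatGraph n).Adj v.val z'.val from hz')
  have hy' : y.val = v.val * swap p q := by rw [hv, one_mul, hy]
  have hne : swap p q ≠ swap e f := fun he => hyz (Subtype.ext (by rw [hy', hze, he]))
  have hne' : swap p q ≠ swap i j := fun he => hyz' (Subtype.ext (by rw [hy', hzi, he]))
  have hne2 : swap e f ≠ swap i j := fun he => hzz (Subtype.ext (by rw [hze, hzi, he]))
  have a1' : (bruhatGraph n).Adj (v.val * swap p q) u₁.val := hy' ▸ a1
  have a2' : (bruhatGraph n).Adj (v.val * swap p q) u₂.val := hy' ▸ a2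
  have b1' : (bruhatGraph n).Adj (v.val * swap e f) u₁.val := hze ▸ b1
  have b2' : (bruhatGraph n).Adj (v.val * swap e f) u₂.val := hze ▸ b2
  have c1' : (bruhatGraph n).Adj (v.val * swap i j) u₁.val := hzi ▸ c1
  have c2' : (bruhatGraph n).Adj (v.val * swap i j) u₂.val := hzi ▸ c2
  have hu' : u₁.val ≠ u₂.val := fun he => hu (Subtype.ext he)
  have hu1' : u₁.val ≠ v.val := fun he => hu1 (Subtype.ext he)
  have hu2' : u₂.val ≠ v.val := fun he => hu2 (Subtype.ext he)
  have k1 := eq_and_eq_of_two_common hpq hef hne hu' hu1' hu2' ⟨a1', b1'⟩ ⟨a2', b2'⟩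
  have k2 := eq_and_eq_of_two_common hpq hij hne' hu' hu1' hu2' ⟨a1', c1'⟩ ⟨a2', c2'⟩
  rw [hv] at k1 k2 hze hzi
  simp only [one_mul] at k1 k2 hze hzi
  have hcomm : swap p q * swap e f ≠ swap e f * swap p q := by
    intro hc
    rcases k1 with ⟨h1, h2⟩ | ⟨h1, h2⟩ <;> exact hu' (by rw [h1, h2, hc])
  have hprod : swap p q * swap e f = swap i j * swap p q := by
    rcases k1 with ⟨h1, h2⟩ | ⟨h1, h2⟩ <;> rcases k2 with ⟨h3, h4⟩ | ⟨h3, h4⟩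
    · exact absurd (mul_left_cancel (h1.symm.trans h3)) hne2
    · exact h1.symm.trans h3
    · exact h2.symm.trans h4
    · exact absurd (mul_left_cancel (h2.symm.trans h4)) hne2
  have hz'e : swap i j = swap (swap p q e) (swap p q f) := by
    rw [mul_swap_eq_swap_mul] at hprod
    exact (mul_right_cancel hprod).symm
  rw [hze, hzi, hz'e]
  by_cases hep : e = p
  · subst hep
    have hfq : f ≠ q := by rintro rfl; exact hne rfl
    exact ⟨f, hef.symm, hfq, Or.inl ⟨rfl, by
      rw [swap_apply_left, swap_apply_of_ne_of_ne hef.symm hfq]⟩⟩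
  by_cases heq : e = q
  · subst heq
    have hfq : f ≠ p := by rintro rfl; exact hne (swap_comm _ _)
    exact ⟨f, hfq, hef.symm, Or.inr ⟨rfl, by
      rw [swap_apply_right, swap_apply_of_ne_of_ne hfq hef.symm]⟩⟩
  by_cases hfp : f = p
  · subst hfp
    exact ⟨e, hep, heq, Or.inl ⟨swap_comm _ _, by
      rw [swap_apply_left, swap_apply_of_ne_of_ne hep heq, swap_comm]⟩⟩
  by_cases hfq : f = q
  · subst hfq
    exact ⟨e, hep, heq, Or.inr ⟨swap_comm _ _, by
      rw [swap_apply_right, swap_apply_of_ne_of_ne hep heq, swap_comm]⟩⟩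
  exact absurd (swap_mul_swap_comm (Ne.symm hep) (Ne.symm hfp) (Ne.symm heq) (Ne.symm hfq)) hcomm

/-- If `(a c) ≤ w` with `a < b < c`, then both 3-cycles on these positions are below `w`. -/
theorem le_of_swap_le {n : ℕ} {w : Perm (Fin n)} {a b c : Fin n} (hab : a < b) (hbc : b < c)
    (h : Le (swap a c) w) :
    Le (swap a c * swap a b) w ∧ Le (swap a c * swap b c) w := by
  have hac := hab.trans hbc
  refine ⟨(mul_swap_le hab ?_).trans h, (mul_swap_le hbc ?_).trans h⟩
  · rwa [swap_apply_left, swap_apply_of_ne_of_ne hab.ne' hbc.ne]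
  · rwa [swap_apply_right, swap_apply_of_ne_of_ne hab.ne' hbc.ne]

theorem hasTwoCommon_of_le {n : ℕ} {w : Perm (Fin n)} {v y z : interval 1 w}
    {p q p' q' : Fin n} (hpq : p ≠ q) (hpq' : p' ≠ q') (hy : y.val = v.val * swap p q)
    (hz : z.val = v.val * swap p' q') (h1 : Le (v.val * swap p q * swap p' q') w)
    (h2 : Le (v.val * swap p' q' * swap p q) w)
    (hc : swap p q * swap p' q' ≠ swap p' q' * swap p q) :
    HasTwoCommon (intervalGraph 1 w) v y z := by
  have hne : swap p q ≠ swap p' q' := fun he => hc (by rw [he])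
  refine ⟨vertex _ h1, vertex _ h2, ?_, ?_, ?_, ⟨?_, ?_⟩, ?_, ?_⟩
  · intro he
    have := congrArg Subtype.val he
    simp only [vertex, mul_assoc, mul_right_inj] at this
    exact hc this
  · intro he
    have := congrArg Subtype.val he
    simp only [vertex, mul_assoc, mul_eq_left] at this
    rw [mul_eq_one_iff_eq_inv, swap_inv] at this
    exact hne this
  · intro he
    have := congrArg Subtype.val he
    simp only [vertex, mul_assoc, mul_eq_left] at this
    rw [mul_eq_one_iff_eq_inv, swap_inv] at this
    exact hne this.symm
  · change (bruhatGraph n).Adj y.val _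
    rw [hy]
    exact adj_mul_swap _ hpq'
  · change (bruhatGraph n).Adj z.val _
    rw [hz]
    exact adj_mul_swap_mul _ _ hpq
  · change (bruhatGraph n).Adj y.val _
    rw [hy]
    exact adj_mul_swap_mul _ _ hpq'
  · change (bruhatGraph n).Adj z.val _
    rw [hz]
    exact adj_mul_swap _ hpq

theorem swap_mul_swap_ne {α : Type*} [DecidableEq α] {p r s : α} (hpr : p ≠ r) (hps : p ≠ s)
    (hrs : r ≠ s) : swap p r * swap p s ≠ swap p s * swap p r := by
  intro h
  have := congrArg (fun g : Perm α => g r) h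
  simp only [Perm.mul_apply, swap_apply_right, swap_apply_left,
    swap_apply_of_ne_of_ne hpr.symm hrs] at this
  exact hps this

/-- Two of the three positions given by the blades of a windmill at `1` lie on the same side of `p`;
the corresponding neighbours `(p r)` and `(p s)` of `1` then have the two 3-cycles on `p`, `r`, `s` as
common neighbours. -/
theorem not_hasWindmill_one {n : ℕ} (w : Perm (Fin n)) :
    ¬ HasWindmill (intervalGraph 1 w) (vertex 1 (one_le w)) := by
  rintro ⟨y, z, z', hy, hz, hzz⟩
  set v : interval 1 w := vertex 1 (one_le w) with hvdef
  have hv : v.val = 1 := rfl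
  obtain ⟨p, q, hpq, hyv⟩ := bruhatGraph_adj.mp (show (bruhatGraph n).Adj v.val y.val from hy)
  rw [hv, one_mul] at hyv
  have hex : ∀ i, ∃ (r : Fin n) (ζ : interval 1 w), r ≠ p ∧ (ζ = z i ∨ ζ = z' i) ∧
      ζ.val = swap p r ∧ HasTwoCommon (intervalGraph 1 w) v ζ ζ := by
    intro i
    obtain ⟨h1, h2, h3, h4, h5, h6⟩ := hz i
    obtain ⟨r, hrp, -, ⟨h7, -⟩ | ⟨-, h7⟩⟩ :=
      exists_third_position hpq hv hyv h1 h2 h3 h4 h5 h6 <;>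
    obtain ⟨u₁, u₂, a, b, c, ⟨-, d1, d2⟩, ⟨-, e1, e2⟩⟩ := h6
    · exact ⟨r, z i, hrp, Or.inl rfl, h7, u₁, u₂, a, b, c, ⟨d1, d1⟩, ⟨e1, e1⟩⟩
    · exact ⟨r, z' i, hrp, Or.inr rfl, h7, u₁, u₂, a, b, c, ⟨d2, d2⟩, ⟨e2, e2⟩⟩
  choose r ζ hrp hζ hζr hself using hex
  have hno : ∀ i j, i ≠ j → ¬ HasTwoCommon (intervalGraph 1 w) v (ζ i) (ζ j) := by
    intro i j hij h
    obtain ⟨h1, h2, h3⟩ := hzz i j hij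
    obtain ⟨-, h4, -⟩ := hzz j i hij.symm
    rcases hζ i with e1 | e1 <;> rcases hζ j with e2 | e2 <;> rw [e1, e2] at h
    exacts [h1 h, h2 h, h4 h.symm, h3 h]
  have hinj : ∀ i j, i ≠ j → r i ≠ r j := by
    intro i j hij he
    have : ζ i = ζ j := Subtype.ext (by rw [hζr, hζr, he])
    have h1 := hself i
    nth_rewrite 2 [this] at h1
    exact hno i j hij h1
  have hside : ∃ i j, i ≠ j ∧ (p < r i ↔ p < r j) := by
    by_cases h0 : p < r 0 <;> by_cases h1 : p < r 1 <;> by_cases h2 : p < r 2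
    all_goals first
      | exact ⟨0, 1, by decide, iff_of_true h0 h1⟩
      | exact ⟨0, 1, by decide, iff_of_false h0 h1⟩
      | exact ⟨0, 2, by decide, iff_of_true h0 h2⟩
      | exact ⟨0, 2, by decide, iff_of_false h0 h2⟩
      | exact ⟨1, 2, by decide, iff_of_true h1 h2⟩
      | exact ⟨1, 2, by decide, iff_of_false h1 h2⟩
  obtain ⟨i, j, hij, hs⟩ := hside
  wlog hlt : r i < r j generalizing i j
  · exact this j i hij.symm hs.symm (lt_of_le_of_ne (not_lt.mp hlt) (hinj i j hij).symm)
  have hlei : Le (swap p (r i)) w := hζr i ▸ (ζ i).2.2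
  have hlej : Le (swap p (r j)) w := hζr j ▸ (ζ j).2.2
  have hle : Le (swap p (r i) * swap p (r j)) w ∧ Le (swap p (r j) * swap p (r i)) w := by
    by_cases hp : p < r i
    · obtain ⟨h1, h2⟩ := le_of_swap_le hp hlt hlej
      rw [swap_mul_swap_eq (hrp i).symm hlt.ne]
      exact ⟨h2, h1⟩
    · have hjp : r j < p := lt_of_le_of_ne (not_lt.mp (hs.not.mp hp)) (hrp j)
      rw [swap_comm p (r i)] at hlei
      obtain ⟨h1, h2⟩ := le_of_swap_le hlt hjp hlei
      rw [swap_mul_swap_eq (hrp j).symm hlt.ne', swap_comm p (r i), swap_comm p (r j),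
        swap_comm (r j) (r i)]
      exact ⟨h2, h1⟩
  exact hno i j hij (hasTwoCommon_of_le (hrp i).symm (hrp j).symm (by rw [hv, one_mul, hζr])
    (by rw [hv, one_mul, hζr]) (by rw [hv, one_mul]; exact hle.1)
    (by rw [hv, one_mul]; exact hle.2)
    (swap_mul_swap_ne (hrp i).symm (hrp j).symm (hinj i j hij)))

/-! ### Windmills at the top of the interval -/

/-- A windmill at `w` whose shared edge is multiplication by `(p q)`, and whose blades belong to the
positions `r i`: the `i`-th one consists of permutations of `w` at the positions `p`, `q`, `r i`.
Transpositions `(p r i)` and `(q r j)` in different blades commute, and so have only one further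
common neighbour. -/
theorem hasWindmill_top {n : ℕ} {w : Perm (Fin n)} {p q : Fin n} {r : Fin 3 → Fin n}
    (hpq : p ≠ q) (hpr : ∀ i, p ≠ r i) (hqr : ∀ i, q ≠ r i) (hr : ∀ i j, i ≠ j → r i ≠ r j)
    (h1 : Le (w * swap p q) w)
    (h2 : ∀ i, Le (w * swap p (r i)) w ∧ Le (w * swap q (r i)) w ∧
      Le (w * swap p q * swap p (r i)) w ∧ Le (w * swap p (r i) * swap p q) w)
    (h3 : ∀ i j, i ≠ j →
      ¬ (Le (w * swap p (r i) * swap p (r j)) w ∧ Le (w * swap p (r j) * swap p (r i)) w))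
    (h4 : ∀ i j, i ≠ j →
      ¬ (Le (w * swap q (r i) * swap q (r j)) w ∧ Le (w * swap q (r j) * swap q (r i)) w)) :
    HasWindmill (intervalGraph 1 w) (vertex w (Le.refl w)) := by
  refine ⟨vertex _ h1, fun i => vertex _ (h2 i).1, fun i => vertex _ (h2 i).2.1,
    adj_mul_swap w hpq, fun i => ⟨adj_mul_swap w (hpr i), adj_mul_swap w (hqr i), ?_, ?_, ?_,
      vertex _ (h2 i).2.2.1, vertex _ (h2 i).2.2.2, ?_, ?_, ?_, ⟨?_, ?_, ?_⟩, ⟨?_, ?_, ?_⟩⟩,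
    fun i j hij => ⟨fun h => ?_, fun h => ?_, fun h => ?_⟩⟩
  · intro he
    have := congrArg Subtype.val he
    simp only [vertex, mul_right_inj] at this
    exact swap_ne_swap hpq.symm hpq.symm (hqr i) (by rw [swap_comm q p]; exact this)
  · intro he
    have := congrArg Subtype.val he
    simp only [vertex, mul_right_inj] at this
    exact swap_ne_swap hpq hpq (hpr i) this
  · intro he
    have := congrArg Subtype.val he
    simp only [vertex, mul_right_inj] at this
    exact swap_ne_swap (hpr i) hpq (hpr i) this
  · intro he
    have := congrArg Subtype.val he
    simp only [vertex, mul_assoc, mul_right_inj] at this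
    exact swap_mul_swap_ne hpq (hpr i) (hqr i) this
  · intro he
    have := congrArg Subtype.val he
    simp only [vertex, mul_assoc, mul_eq_left] at this
    rw [mul_eq_one_iff_eq_inv, swap_inv] at this
    exact swap_ne_swap hpq.symm hpq.symm (hqr i) (by rw [swap_comm q p]; exact this)
  · intro he
    have := congrArg Subtype.val he
    simp only [vertex, mul_assoc, mul_eq_left] at this
    rw [mul_eq_one_iff_eq_inv, swap_inv] at this
    exact swap_ne_swap hpq.symm hpq.symm (hqr i) (by rw [swap_comm q p]; exact this.symm)
  · exact adj_mul_swap _ (hpr i)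
  · exact adj_mul_swap_mul _ _ hpq
  · change (bruhatGraph n).Adj _ (w * swap p q * swap p (r i))
    rw [mul_assoc, swap_mul_swap_eq' (hpr i) (hqr i).symm, ← mul_assoc, swap_comm (r i) q]
    exact adj_mul_swap _ hpq
  · exact adj_mul_swap_mul _ _ (hpr i)
  · exact adj_mul_swap _ hpq
  · change (bruhatGraph n).Adj _ (w * swap p (r i) * swap p q)
    rw [mul_assoc, swap_mul_swap_eq' hpq (hqr i), ← mul_assoc]
    exact adj_mul_swap _ (hpr i)
  · have hne : swap p (r i) ≠ swap p (r j) := by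
      rw [swap_comm p (r i)]
      exact swap_ne_swap (hpr i).symm (hpr i).symm (hr i j hij)
    have := h.le_and_le (hpr i) (hpr j) hne rfl rfl
    exact h3 i j hij ⟨this.1, this.2.1⟩
  · have hne : swap p (r i) ≠ swap q (r j) := swap_ne_swap (hpr i) hpq (hpr j)
    have := h.le_and_le (hpr i) (hqr j) hne rfl rfl
    exact this.2.2 (swap_mul_swap_comm hpq (hpr j) (hqr i).symm (hr i j hij))
  · have hne : swap q (r i) ≠ swap q (r j) := by
      rw [swap_comm q (r i)]
      exact swap_ne_swap (hqr i).symm (hqr i).symm (hr i j hij)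
    have := h.le_and_le (hqr i) (hqr j) hne rfl rfl
    exact h4 i j hij ⟨this.1, this.2.1⟩

/-- At positions `a < b < c` with `w a < w b`, the 3-cycle moving `w b` to position `a` leaves the
lower interval. -/
theorem not_le_of_ascent {n : ℕ} {w : Perm (Fin n)} {a b c : Fin n} (hab : a < b)
    (hbc : b < c) (h : w a < w b) : ¬ Le (w * swap b c * swap a c) w := by
  have hac := hab.trans hbc
  refine not_le_of_forall b.val (w b).val (fun r hr hr' => ?_) a hab h ?_ <;>
  · simp only [mul_swap_apply]
    grind

/-- At positions `a < b < c` forming the pattern 312, the rearrangement 231 leaves the lower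
interval. -/
theorem not_le_of_pattern_312 {n : ℕ} {w : Perm (Fin n)} {a b c : Fin n} (hab : a < b)
    (hbc : b < c) (h1 : w b < w c) (h2 : w c < w a) : ¬ Le (w * swap a b * swap a c) w := by
  have hac := hab.trans hbc
  refine not_le_of_forall c.val (w c).val (fun r hr hr' => ?_) b hbc h1 ?_ <;>
  · simp only [mul_swap_apply]
    grind

theorem le_of_pattern_321 {n : ℕ} {w : Perm (Fin n)} {a b c : Fin n} (hab : a < b)
    (hbc : b < c) (h1 : w c < w b) (h2 : w b < w a) :
    (Le (w * swap a b) w ∧ Le (w * swap a c) w ∧ Le (w * swap b c) w) ∧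
      Le (w * swap b c * swap a c) w ∧ Le (w * swap a b * swap a c) w := by
  have hac := hab.trans hbc
  have h3 : Le (w * swap a b) w := mul_swap_le hab h2
  have h4 : Le (w * swap b c) w := mul_swap_le hbc h1
  refine ⟨⟨h3, mul_swap_le hac (h1.trans h2), h4⟩, (mul_swap_le hac ?_).trans h4,
    (mul_swap_le hac ?_).trans h3⟩ <;>
  · simp only [mul_swap_apply]
    grind

theorem not_isVertexTransitive_of_hasWindmill {n : ℕ} {w : Perm (Fin n)}
    (h : HasWindmill (intervalGraph 1 w) (vertex w (Le.refl w))) :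
    ¬ IsVertexTransitive (intervalGraph 1 w) := by
  intro ht
  obtain ⟨φ, hφ⟩ := ht (vertex w (Le.refl w)) (vertex 1 (one_le w))
  exact not_hasWindmill_one w (hφ ▸ h.map φ)

/-- The shared edge of the windmill exchanges the entries 2 and 1; the blades belong to the entries
3, 4 and 5. -/
theorem not_isVertexTransitive_of_34521 {n : ℕ} {w : Perm (Fin n)} {r : Fin 3 → Fin n}
    {p q : Fin n} (hr : StrictMono r) (hrp : r 2 < p) (hpq : p < q)
    (hwr : StrictMono fun i => w (r i)) (h1 : w p < w (r 0)) (h2 : w q < w p) :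
    ¬ IsVertexTransitive (intervalGraph 1 w) := by
  have hrp' : ∀ i, r i < p := fun i => (hr.monotone (Fin.le_last i)).trans_lt hrp
  have h1' : ∀ i, w p < w (r i) := fun i => h1.trans_le (hwr.monotone (Fin.zero_le i))
  have hbad : ∀ s, (∀ i, r i < s ∧ w s < w (r i)) → ∀ i j, i ≠ j →
      ¬ (Le (w * swap s (r i) * swap s (r j)) w ∧ Le (w * swap s (r j) * swap s (r i)) w) := by
    intro s hs i j hij h
    wlog hlt : i < j generalizing i j
    · exact this j i hij.symm h.symm (lt_of_le_of_ne (not_lt.mp hlt) hij.symm)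
    have := not_le_of_ascent (hr hlt) (hs j).1 (hwr hlt)
    rw [swap_comm (r j), swap_comm (r i)] at this
    exact this h.2
  refine not_isVertexTransitive_of_hasWindmill (hasWindmill_top (p := p) (q := q) (r := r) hpq.ne
    (fun i => (hrp' i).ne') (fun i => ((hrp' i).trans hpq).ne') (fun i j hij => hr.injective.ne hij)
    (mul_swap_le hpq h2) (fun i => ?_) (hbad p fun i => ⟨hrp' i, h1' i⟩)
    (hbad q fun i => ⟨(hrp' i).trans hpq, h2.trans (h1' i)⟩))
  obtain ⟨⟨k1, k2, k3⟩, k4, k5⟩ := le_of_pattern_321 (hrp' i) hpq h2 (h1' i)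
  have hiq := (hrp' i).trans hpq
  refine ⟨by rwa [swap_comm], by rwa [swap_comm], ?_, ?_⟩
  · have : swap p q * swap p (r i) = swap (r i) p * swap (r i) q := by
      rw [swap_comm p (r i), swap_mul_swap_eq (hrp' i).ne hpq.ne, swap_comm (r i) q,
        swap_comm p q, swap_comm (r i) p, swap_mul_swap_eq hiq.ne' (hrp' i).ne, swap_comm p]
    rwa [mul_assoc, this, ← mul_assoc]
  · have : swap p (r i) * swap p q = swap p q * swap (r i) q :=
      swap_mul_swap_eq (hrp' i).ne' hiq.ne
    rwa [mul_assoc, this, ← mul_assoc]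

/-- The shared edge of the windmill exchanges the entries 5 and 4; the blades belong to the entries
1, 2 and 3. -/
theorem not_isVertexTransitive_of_54123 {n : ℕ} {w : Perm (Fin n)} {r : Fin 3 → Fin n}
    {p q : Fin n} (hr : StrictMono r) (hpq : p < q) (hqr : q < r 0)
    (hwr : StrictMono fun i => w (r i)) (h1 : w (r 2) < w q) (h2 : w q < w p) :
    ¬ IsVertexTransitive (intervalGraph 1 w) := by
  have hqr' : ∀ i, q < r i := fun i => hqr.trans_le (hr.monotone (Fin.zero_le i))
  have h1' : ∀ i, w (r i) < w q := fun i => (hwr.monotone (Fin.le_last i)).trans_lt h1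
  have hbad : ∀ s, (∀ i, s < r i ∧ w (r i) < w s) → ∀ i j, i ≠ j →
      ¬ (Le (w * swap s (r i) * swap s (r j)) w ∧ Le (w * swap s (r j) * swap s (r i)) w) := by
    intro s hs i j hij h
    wlog hlt : i < j generalizing i j
    · exact this j i hij.symm h.symm (lt_of_le_of_ne (not_lt.mp hlt) hij.symm)
    exact not_le_of_pattern_312 (hs i).1 (hr hlt) (hwr hlt) (hs j).2 h.1
  refine not_isVertexTransitive_of_hasWindmill (hasWindmill_top (p := p) (q := q) (r := r) hpq.ne
    (fun i => (hpq.trans (hqr' i)).ne) (fun i => (hqr' i).ne) (fun i j hij => hr.injective.ne hij)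
    (mul_swap_le hpq h2) (fun i => ?_) (hbad p fun i => ⟨hpq.trans (hqr' i), (h1' i).trans h2⟩)
    (hbad q fun i => ⟨hqr' i, h1' i⟩))
  obtain ⟨⟨k1, k2, k3⟩, k4, k5⟩ := le_of_pattern_321 hpq (hqr' i) (h1' i) h2
  refine ⟨k2, k3, k5, ?_⟩
  rwa [mul_assoc, swap_mul_swap_eq' hpq.ne (hqr' i).ne, ← mul_assoc]

theorem avoidsPattern_of_isVertexTransitive {n : ℕ} {w : Perm (Fin n)}
    (h : IsVertexTransitive (intervalGraph 1 w)) :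
    AvoidsPattern w ![3, 4, 1, 2] ∧ AvoidsPattern w ![4, 2, 3, 1] ∧
      AvoidsPattern w ![3, 4, 5, 2, 1] ∧ AvoidsPattern w ![5, 4, 1, 2, 3] := by
  refine ⟨?_, ?_, ?_, ?_⟩ <;> rintro ⟨a, ha, hw⟩
  · exact not_isVertexTransitive_of_3412 (ha (show (0 : Fin 4) < 1 by decide))
      (ha (show (1 : Fin 4) < 2 by decide)) (ha (show (2 : Fin 4) < 3 by decide))
      ((hw 2 3).mpr (by decide)) ((hw 3 0).mpr (by decide)) ((hw 0 1).mpr (by decide)) h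
  · exact not_isVertexTransitive_of_4231 (ha (show (0 : Fin 4) < 1 by decide))
      (ha (show (1 : Fin 4) < 2 by decide)) (ha (show (2 : Fin 4) < 3 by decide))
      ((hw 3 1).mpr (by decide)) ((hw 1 2).mpr (by decide)) ((hw 2 0).mpr (by decide)) h
  · refine not_isVertexTransitive_of_34521 (r := ![a 0, a 1, a 2]) (p := a 3) (q := a 4)
      ?_ (ha (show (2 : Fin 5) < 3 by decide)) (ha (show (3 : Fin 5) < 4 by decide)) ?_
      ((hw 3 0).mpr (by decide)) ((hw 4 3).mpr (by decide)) h
    · rw [Fin.strictMono_iff_lt_succ]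
      intro i
      fin_cases i
      · exact ha (show (0 : Fin 5) < 1 by decide)
      · exact ha (show (1 : Fin 5) < 2 by decide)
    · rw [Fin.strictMono_iff_lt_succ]
      intro i
      fin_cases i
      · exact (hw 0 1).mpr (by decide)
      · exact (hw 1 2).mpr (by decide)
  · refine not_isVertexTransitive_of_54123 (r := ![a 2, a 3, a 4]) (p := a 0) (q := a 1)
      ?_ (ha (show (0 : Fin 5) < 1 by decide)) (ha (show (1 : Fin 5) < 2 by decide)) ?_
      ((hw 4 1).mpr (by decide)) ((hw 1 0).mpr (by decide)) h
    · rw [Fin.strictMono_iff_lt_succ]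
      intro i
      fin_cases i
      · exact ha (show (2 : Fin 5) < 3 by decide)
      · exact ha (show (3 : Fin 5) < 4 by decide)
    · rw [Fin.strictMono_iff_lt_succ]
      intro i
      fin_cases i
      · exact (hw 2 3).mpr (by decide)
      · exact (hw 3 4).mpr (by decide)

/-! ### Pattern avoidance for permutations of a linear order -/

/-- The function `w` has no four or five positions at which its values form one of the patterns 3412,
4231, 34521 and 54123. -/
structure AvoidsAll {α : Type*} [LinearOrder α] (w : α → α) : Prop where
  not3412 : ∀ ⦃a b c d⦄, a < b → b < c → c < d → w c < w d → w d < w a → w a < w b → False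
  not4231 : ∀ ⦃a b c d⦄, a < b → b < c → c < d → w d < w b → w b < w c → w c < w a → False
  not34521 : ∀ ⦃a b c d e⦄, a < b → b < c → c < d → d < e →
    w e < w d → w d < w a → w a < w b → w b < w c → False
  not54123 : ∀ ⦃a b c d e⦄, a < b → b < c → c < d → d < e →
    w c < w d → w d < w e → w e < w b → w b < w a → False

theorem AvoidsAll.symm {α : Type*} [LinearOrder α] {w : Perm α} (h : AvoidsAll w) :
    AvoidsAll w.symm where
  not3412 a b c d h1 h2 h3 h4 h5 h6 := h.not3412 h4 h5 h6 (by simpa) (by simpa) (by simpa)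
  not4231 a b c d h1 h2 h3 h4 h5 h6 := h.not4231 h4 h5 h6 (by simpa) (by simpa) (by simpa)
  not34521 a b c d e h1 h2 h3 h4 h5 h6 h7 h8 :=
    h.not54123 h5 h6 h7 h8 (by simpa) (by simpa) (by simpa) (by simpa)
  not54123 a b c d e h1 h2 h3 h4 h5 h6 h7 h8 :=
    h.not34521 h5 h6 h7 h8 (by simpa) (by simpa) (by simpa) (by simpa)

/-- Each entry of the four patterns belongs to an inversion. So an occurrence cannot involve
a position which forms no inversion with any other. -/
theorem AvoidsAll.transfer {α β : Type*} [LinearOrder α] [LinearOrder β] {u : α → α} {w : β → β}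
    (h : AvoidsAll w) (P : Set α) (ρ : α → β) (hρ : ∀ p ∈ P, ∀ q ∈ P, p < q → ρ p < ρ q)
    (hu : ∀ p ∈ P, ∀ q ∈ P, u p < u q → w (ρ p) < w (ρ q))
    (hP : ∀ p ∉ P, ∀ q, (q < p → u q < u p) ∧ (p < q → u p < u q)) : AvoidsAll u := by
  have key : ∀ p q, p < q → u q < u p → p ∈ P ∧ q ∈ P := by
    intro p q h1 h2
    constructor <;> by_contra hm
    · exact lt_asymm h2 ((hP _ hm _).2 h1)
    · exact lt_asymm h2 ((hP _ hm _).1 h1)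
  constructor
  · intro a b c d h1 h2 h3 h4 h5 h6
    obtain ⟨ha, hd⟩ := key a d (by order) (by order)
    obtain ⟨hb, hc⟩ := key b c (by order) (by order)
    exact h.not3412 (hρ _ ha _ hb h1) (hρ _ hb _ hc h2) (hρ _ hc _ hd h3)
      (hu _ hc _ hd h4) (hu _ hd _ ha h5) (hu _ ha _ hb h6)
  · intro a b c d h1 h2 h3 h4 h5 h6
    obtain ⟨ha, hb⟩ := key a b (by order) (by order)
    obtain ⟨hc, hd⟩ := key c d (by order) (by order)
    exact h.not4231 (hρ _ ha _ hb h1) (hρ _ hb _ hc h2) (hρ _ hc _ hd h3)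
      (hu _ hd _ hb h4) (hu _ hb _ hc h5) (hu _ hc _ ha h6)
  · intro a b c d e h1 h2 h3 h4 h5 h6 h7 h8
    obtain ⟨ha, hd⟩ := key a d (by order) (by order)
    obtain ⟨hb, he⟩ := key b e (by order) (by order)
    obtain ⟨hc, -⟩ := key c e (by order) (by order)
    exact h.not34521 (hρ _ ha _ hb h1) (hρ _ hb _ hc h2) (hρ _ hc _ hd h3) (hρ _ hd _ he h4)
      (hu _ he _ hd h5) (hu _ hd _ ha h6) (hu _ ha _ hb h7) (hu _ hb _ hc h8)
  · intro a b c d e h1 h2 h3 h4 h5 h6 h7 h8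
    obtain ⟨ha, hc⟩ := key a c (by order) (by order)
    obtain ⟨hb, hd⟩ := key b d (by order) (by order)
    obtain ⟨-, he⟩ := key a e (by order) (by order)
    exact h.not54123 (hρ _ ha _ hb h1) (hρ _ hb _ hc h2) (hρ _ hc _ hd h3) (hρ _ hd _ he h4)
      (hu _ hc _ hd h5) (hu _ hd _ he h6) (hu _ he _ hb h7) (hu _ hb _ ha h8)

theorem containsPattern_of {n k : ℕ} {w : Perm (Fin n)} {p : Fin k → ℕ} (hp : p.Injective)
    (a : Fin k → Fin n) (ha : StrictMono a) (h : ∀ i j, p i < p j → w (a i) < w (a j)) :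
    ContainsPattern w p := by
  refine ⟨a, ha, fun i j => ⟨fun h1 => ?_, h i j⟩⟩
  by_contra h2
  rcases eq_or_lt_of_le (not_lt.mp h2) with h3 | h3
  · rw [hp h3] at h1
    exact lt_irrefl _ h1
  · exact lt_asymm h1 (h j i h3)

theorem avoidsAll_of_avoidsPattern {n : ℕ} {w : Perm (Fin n)}
    (h : AvoidsPattern w ![3, 4, 1, 2] ∧ AvoidsPattern w ![4, 2, 3, 1] ∧
      AvoidsPattern w ![3, 4, 5, 2, 1] ∧ AvoidsPattern w ![5, 4, 1, 2, 3]) : AvoidsAll w := by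
  obtain ⟨h1, h2, h3, h4⟩ := h
  constructor
  · intro a b c d a1 a2 a3 a4 a5 a6
    refine h1 (containsPattern_of (by decide) ![a, b, c, d] ?_ ?_)
    · rw [Fin.strictMono_iff_lt_succ]
      intro i
      fin_cases i <;> assumption
    · intro i j hij
      fin_cases i <;> fin_cases j <;> first
        | exact absurd hij (by decide)
        | (simp only [Fin.zero_eta, Fin.mk_one, Fin.reduceFinMk, Matrix.cons_val]; order)
  · intro a b c d a1 a2 a3 a4 a5 a6
    refine h2 (containsPattern_of (by decide) ![a, b, c, d] ?_ ?_)
    · rw [Fin.strictMono_iff_lt_succ]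
      intro i
      fin_cases i <;> assumption
    · intro i j hij
      fin_cases i <;> fin_cases j <;> first
        | exact absurd hij (by decide)
        | (simp only [Fin.zero_eta, Fin.mk_one, Fin.reduceFinMk, Matrix.cons_val]; order)
  · intro a b c d e a1 a2 a3 a4 a5 a6 a7 a8
    refine h3 (containsPattern_of (by decide) ![a, b, c, d, e] ?_ ?_)
    · rw [Fin.strictMono_iff_lt_succ]
      intro i
      fin_cases i <;> assumption
    · intro i j hij
      fin_cases i <;> fin_cases j <;> first
        | exact absurd hij (by decide)
        | (simp only [Fin.zero_eta, Fin.mk_one, Fin.reduceFinMk, Matrix.cons_val]; order)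
  · intro a b c d e a1 a2 a3 a4 a5 a6 a7 a8
    refine h4 (containsPattern_of (by decide) ![a, b, c, d, e] ?_ ?_)
    · rw [Fin.strictMono_iff_lt_succ]
      intro i
      fin_cases i <;> assumption
    · intro i j hij
      fin_cases i <;> fin_cases j <;> first
        | exact absurd hij (by decide)
        | (simp only [Fin.zero_eta, Fin.mk_one, Fin.reduceFinMk, Matrix.cons_val]; order)

/-! ### Inseparable permutations avoiding the four patterns -/

/-- A permutation of `ℤ` supported on `[a, b]` which avoids the four patterns and which, for no `c`
strictly between `a` and `b`, splits as a product of permutations supported on `[a, c]`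
and `[c, b]`, in either order. Working in `ℤ` rather than in `Fin n` makes the symmetry `p ↦ -p`
and the successor of a position available. -/
structure IsInseparable (w : Perm ℤ) (a b : ℤ) : Prop where
  avoids : AvoidsAll w
  fix : ∀ p, p < a ∨ b < p → w p = p
  up : ∀ c, a < c → c < b → ∃ p, p < c ∧ c < w p
  down : ∀ c, a < c → c < b → ∃ p, c < p ∧ w p < c

theorem fix_symm {w : Perm ℤ} {a b : ℤ} (h : ∀ p, p < a ∨ b < p → w p = p) :
    ∀ p, p < a ∨ b < p → w.symm p = p := fun p hp => by
  rw [symm_apply_eq, h p hp]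

theorem IsInseparable.symm {w : Perm ℤ} {a b : ℤ} (h : IsInseparable w a b) :
    IsInseparable w.symm a b where
  avoids := h.avoids.symm
  fix := fix_symm h.fix
  up c h1 h2 := by
    obtain ⟨p, hp, hw⟩ := h.down c h1 h2
    exact ⟨w p, hw, by simpa⟩
  down c h1 h2 := by
    obtain ⟨p, hp, hw⟩ := h.up c h1 h2
    exact ⟨w p, hw, by simpa⟩

/-- The conjugate of `w` by `p ↦ -p`. -/
def negConj (w : Perm ℤ) : Perm ℤ := ((Equiv.neg ℤ).trans w).trans (Equiv.neg ℤ)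

theorem negConj_apply (w : Perm ℤ) (p : ℤ) : negConj w p = -w (-p) := rfl

theorem negConj_symm_apply (w : Perm ℤ) (p : ℤ) : (negConj w).symm p = -w.symm (-p) := rfl

theorem IsInseparable.negConj {w : Perm ℤ} {a b : ℤ} (h : IsInseparable w a b) :
    IsInseparable (negConj w) (-b) (-a) where
  avoids := by
    constructor <;> simp only [negConj_apply, neg_lt_neg_iff]
    · intro a b c d h1 h2 h3 h4 h5 h6
      exact h.avoids.not3412 (neg_lt_neg h3) (neg_lt_neg h2) (neg_lt_neg h1) h6 h5 h4
    · intro a b c d h1 h2 h3 h4 h5 h6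
      exact h.avoids.not4231 (neg_lt_neg h3) (neg_lt_neg h2) (neg_lt_neg h1) h6 h5 h4
    · intro a b c d e h1 h2 h3 h4 h5 h6 h7 h8
      exact h.avoids.not54123 (neg_lt_neg h4) (neg_lt_neg h3) (neg_lt_neg h2) (neg_lt_neg h1)
        h8 h7 h6 h5
    · intro a b c d e h1 h2 h3 h4 h5 h6 h7 h8
      exact h.avoids.not34521 (neg_lt_neg h4) (neg_lt_neg h3) (neg_lt_neg h2) (neg_lt_neg h1)
        h8 h7 h6 h5
  fix p hp := by
    rw [negConj_apply, h.fix (-p) (by omega), neg_neg]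
  up c h1 h2 := by
    obtain ⟨p, hp, hw⟩ := h.down (-c) (by omega) (by omega)
    exact ⟨-p, by omega, by rw [negConj_apply, neg_neg]; omega⟩
  down c h1 h2 := by
    obtain ⟨p, hp, hw⟩ := h.up (-c) (by omega) (by omega)
    exact ⟨-p, by omega, by rw [negConj_apply, neg_neg]; omega⟩

/-- A permutation of finite support has as many positions `≤ c` with value `> c` as positions `> c`
with value `≤ c`. -/
theorem exists_crossings {w : Perm ℤ} {a b : ℤ} (h : ∀ p, p < a ∨ b < p → w p = p) (c : ℤ) :
    ∃ s t : Finset ℤ, s.card = t.card ∧ (∀ p, p ∈ s ↔ p ≤ c ∧ c < w p) ∧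
      (∀ p, p ∈ t ↔ c < p ∧ w p ≤ c) := by
  have hS : (Finset.Icc a c).card = ((Finset.Icc a c).map w.symm.toEmbedding).card := by simp
  refine ⟨_, _, Finset.card_sdiff_comm hS, fun p => ?_, fun p => ?_⟩
  · simp only [Finset.mem_sdiff, Finset.mem_Icc, Finset.mem_map_equiv, symm_symm]
    constructor
    · rintro ⟨h1, h2⟩
      refine ⟨h1.2, ?_⟩
      by_contra h3
      have h4 : w p < a := by
        by_contra h4
        exact h2 ⟨not_lt.mp h4, not_lt.mp h3⟩
      have h5 := w.injective (h (w p) (Or.inl h4))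
      omega
    · rintro ⟨h1, h2⟩
      refine ⟨⟨?_, h1⟩, fun h3 => by omega⟩
      by_contra h3
      have h4 := h p (by omega)
      omega
  · simp only [Finset.mem_sdiff, Finset.mem_Icc, Finset.mem_map_equiv, symm_symm]
    constructor
    · rintro ⟨h1, h2⟩
      refine ⟨?_, h1.2⟩
      by_contra h3
      have h4 : p < a := by
        by_contra h4
        exact h2 ⟨not_lt.mp h4, not_lt.mp h3⟩
      have h5 := h p (Or.inl h4)
      omega
    · rintro ⟨h1, h2⟩
      refine ⟨⟨?_, h2⟩, fun h3 => by omega⟩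
      by_contra h3
      have h5 := w.injective (h (w p) (by omega))
      omega

theorem exists_down_of_up {w : Perm ℤ} {a b : ℤ} (h : ∀ p, p < a ∨ b < p → w p = p) {c p : ℤ}
    (h1 : p ≤ c) (h2 : c < w p) : ∃ q, c < q ∧ w q ≤ c := by
  obtain ⟨s, t, hst, hs, ht⟩ := exists_crossings h c
  have : 0 < t.card := hst ▸ Finset.card_pos.mpr ⟨p, (hs p).mpr ⟨h1, h2⟩⟩
  obtain ⟨q, hq⟩ := Finset.card_pos.mp this
  exact ⟨q, (ht q).mp hq⟩

theorem exists_two_down_of_up {w : Perm ℤ} {a b : ℤ} (h : ∀ p, p < a ∨ b < p → w p = p)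
    {c p p' : ℤ} (hne : p ≠ p') (h1 : p ≤ c) (h2 : c < w p) (h1' : p' ≤ c) (h2' : c < w p') :
    ∃ q q', q < q' ∧ c < q ∧ w q ≤ c ∧ w q' ≤ c := by
  obtain ⟨s, t, hst, hs, ht⟩ := exists_crossings h c
  have : 1 < t.card := hst ▸ Finset.one_lt_card.mpr
    ⟨p, (hs p).mpr ⟨h1, h2⟩, p', (hs p').mpr ⟨h1', h2'⟩, hne⟩
  obtain ⟨q, hq, q', hq', hne'⟩ := Finset.one_lt_card.mp this
  rw [ht] at hq hq'
  rcases lt_or_gt_of_ne hne' with h3 | h3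
  · exact ⟨q, q', h3, hq.1, hq.2, hq'.2⟩
  · exact ⟨q', q, h3, hq'.1, hq'.2, hq.2⟩

theorem exists_two_up_of_down {w : Perm ℤ} {a b : ℤ} (h : ∀ p, p < a ∨ b < p → w p = p)
    {c p p' : ℤ} (hne : p ≠ p') (h1 : c < p) (h2 : w p ≤ c) (h1' : c < p') (h2' : w p' ≤ c) :
    ∃ q q', q ≠ q' ∧ q ≤ c ∧ c < w q ∧ q' ≤ c ∧ c < w q' := by
  obtain ⟨s, t, hst, hs, ht⟩ := exists_crossings h c
  have : 1 < s.card := hst ▸ Finset.one_lt_card.mpr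
    ⟨p, (ht p).mpr ⟨h1, h2⟩, p', (ht p').mpr ⟨h1', h2'⟩, hne⟩
  obtain ⟨q, hq, q', hq', hne'⟩ := Finset.one_lt_card.mp this
  rw [hs] at hq hq'
  exact ⟨q, q', hne', hq.1, hq.2, hq'.1, hq'.2⟩

theorem IsInseparable.apply_mem {w : Perm ℤ} {a b : ℤ} (h : IsInseparable w a b) {p : ℤ}
    (hp : w p ≠ p) : a ≤ p ∧ p ≤ b := by
  by_contra hc
  exact hp (h.fix p (by omega))

theorem IsInseparable.apply_mem' {w : Perm ℤ} {a b : ℤ} (h : IsInseparable w a b) {p : ℤ}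
    (hp : w p ≠ p) : a ≤ w p ∧ w p ≤ b :=
  h.symm.apply_mem (by simpa using hp.symm)

/-- At an index `k` which is an ascent both of `w` and of `w⁻¹`, the value at `k` does not
exceed `k`. -/
theorem IsInseparable.apply_le_of_ascent {w : Perm ℤ} {a b k : ℤ} (h : IsInseparable w a b)
    (hkb : k < b) (hw : w k < w (k + 1)) (hv : w.symm k < w.symm (k + 1)) : w k ≤ k := by
  by_contra hlt
  obtain ⟨x, hx⟩ : ∃ x, x = w.symm k := ⟨_, rfl⟩
  obtain ⟨y, hy⟩ : ∃ y, y = w.symm (k + 1) := ⟨_, rfl⟩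
  have hwx : w x = k := by rw [hx, apply_symm_apply]
  have hwy : w y = k + 1 := by rw [hy, apply_symm_apply]
  rw [← hx, ← hy] at hv
  have hne : ∀ p q, w p ≠ w q → p ≠ q := fun p q h he => h (he ▸ rfl)
  have hxk : x ≠ k := hne _ _ (by omega)
  have hxk' : x ≠ k + 1 := hne _ _ (by omega)
  have hxk2 : x < k := by
    by_contra hge
    have hyk : w k ≠ w y := w.injective.ne (by omega)
    exact h.avoids.not3412 (lt_add_one k) (by omega) hv (by omega) (by omega) hw
  have hax := (h.apply_mem (p := x) (by omega)).1
  obtain ⟨p, hp, hwp⟩ := h.up k (by omega) hkb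
  obtain ⟨j, j', hjj, hj, hwj, hwj'⟩ :=
    exists_two_down_of_up h.fix (c := k) hp.ne hp.le hwp le_rfl (by omega)
  have hj1 : j ≠ k + 1 := hne _ _ (by omega)
  have hj2 : w j ≠ w j' := w.injective.ne hjj.ne
  have hdec : w j' < w j := by
    by_contra hle
    exact h.avoids.not3412 (lt_add_one k) (by omega) hjj (by omega) (by omega) hw
  have hj3 : w j ≠ w x := w.injective.ne (by omega)
  exact h.avoids.not34521 hxk2 (lt_add_one k) (by omega) hjj hdec (by omega) (by omega) hw

/-- If the index `k` is an ascent both of `w` and of `w⁻¹`, then `w` preserves the positions up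
to `k`. -/
theorem IsInseparable.not_ascent {w : Perm ℤ} {a b k i : ℤ} (h : IsInseparable w a b)
    (hak : a ≤ k) (hkb : k < b) (hw : w k < w (k + 1)) (hv : w.symm k < w.symm (k + 1))
    (hi : i ≤ k) (hwi : k < w i) : False := by
  have h1 : w k ≤ k := h.apply_le_of_ascent hkb hw hv
  have h2 : w.symm k ≤ k := h.symm.apply_le_of_ascent hkb hv (by simpa using hw)
  have h3 : k < w (k + 1) := by
    have e : -(-k - 1) = k + 1 := by ring
    have e' : -(-k - 1 + 1) = k := by ring
    have := h.negConj.apply_le_of_ascent (k := -k - 1) (by omega)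
      (by simp only [negConj_apply, e, e']; omega)
      (by simp only [negConj_symm_apply, e, e']; omega)
    simp only [negConj_apply, e] at this
    omega
  have h4 : k < w.symm (k + 1) := by
    have e : -(-k - 1) = k + 1 := by ring
    have e' : -(-k - 1 + 1) = k := by ring
    have := h.symm.negConj.apply_le_of_ascent (k := -k - 1) (by omega)
      (by simp only [negConj_apply, e, e']; omega)
      (by simp only [negConj_symm_apply, e, e', symm_symm]; omega)
    simp only [negConj_apply, e] at this
    omega
  obtain ⟨x, hx⟩ : ∃ x, x = w.symm k := ⟨_, rfl⟩
  obtain ⟨y, hy⟩ : ∃ y, y = w.symm (k + 1) := ⟨_, rfl⟩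
  have hwx : w x = k := by rw [hx, apply_symm_apply]
  have hwy : w y = k + 1 := by rw [hy, apply_symm_apply]
  rw [← hx] at h2
  rw [← hy] at h4
  obtain ⟨j, hj, hwj⟩ := exists_down_of_up h.fix hi hwi
  have hne : ∀ p q, w p ≠ w q → p ≠ q := fun p q h he => h (he ▸ rfl)
  have hik : i ≠ k := hne _ _ (by omega)
  have hiy : w i ≠ w y := w.injective.ne (by omega)
  have hjk : j ≠ k + 1 := hne _ _ (by omega)
  have hjx : w j ≠ w x := w.injective.ne (by omega)
  have hik' : w i ≠ w (k + 1) := w.injective.ne (by omega)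
  have hjk' : w j ≠ w k := w.injective.ne (by omega)
  have hxi : x ≠ i := hne _ _ (by omega)
  have hyj : y ≠ j := hne _ _ (by omega)
  have p1 := h.avoids.not4231 (a := i) (b := k) (c := k + 1) (d := j) (by omega) (by omega)
    (by omega)
  have p2 := h.avoids.not4231 (a := i) (b := x) (c := y) (d := j)
  rcases lt_or_gt_of_ne hik' with h5 | h5
  · have hyk : y ≠ k + 1 := hne _ _ (by omega)
    have hyj' : y < j := by
      by_contra hle
      exact h.avoids.not3412 (a := i) (b := k + 1) (c := j) (d := y) (by omega) (by omega)
        (by omega) (by omega) (by omega) h5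
    have hxi' : x < i := by
      by_contra hle
      exact p2 (by omega) (by omega) hyj' (by omega) (by omega) (by omega)
    by_cases h6 : w k < w j
    · exact h.avoids.not3412 (a := x) (b := i) (c := k) (d := j) hxi' (by omega) (by omega) h6
        (by omega) (by omega)
    · exact h.avoids.not4231 (a := i) (b := k) (c := y) (d := j) (by omega) (by omega) hyj'
        (by omega) (by omega) (by omega)
  · have h6 : w k < w j := by
      by_contra h6
      exact p1 (by omega) (by omega) h5
    have hxk : x ≠ k := hne _ _ (by omega)
    have hxi' : i < x := by
      by_contra hle
      exact h.avoids.not3412 (a := x) (b := i) (c := k) (d := j) (by omega) (by omega) (by omega)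
        h6 (by omega) (by omega)
    exact h.avoids.not4231 (a := i) (b := x) (c := k + 1) (d := j) hxi' (by omega) (by omega)
      (by omega) (by omega) h5

theorem lt_of_forall_step_int {f : ℤ → ℤ} {m k : ℤ} (h : ∀ c, m ≤ c → c < k → f (c + 1) < f c) :
    ∀ p q, m ≤ p → p < q → q ≤ k → f q < f p := by
  intro p q hp hpq hq
  induction q, hpq using Int.leInduction with
  | base => exact h p hp (by omega)
  | succ q hpq ih => exact (h q (by omega) (by omega)).trans (ih (by omega))

/-- The heart of the matter: an ascent `t` of `w` and an ascent `k` of `w⁻¹` with `t < k`, all indices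
in between being descents of both, force the positions up to `t` to have values at most `k`. If the
value at some `i ≤ t` were greater, inseparability would supply enough further positions whose values
cross `t`, `t + 1` and `k + 1` downwards that every relative order contains one of the patterns. -/
theorem IsInseparable.not_ascent_ascent {w : Perm ℤ} {a b t k i : ℤ} (h : IsInseparable w a b)
    (hkb : k < b) (htk : t < k) (hw : w t < w (t + 1))
    (hv : w.symm k < w.symm (k + 1)) (hdw : ∀ c, t < c → c < k → w (c + 1) < w c)
    (hdv : ∀ c, t < c → c < k → w.symm (c + 1) < w.symm c)
    (hi : i ≤ t) (hwi : k < w i) : False := by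
  have hwanti := lt_of_forall_step_int (f := w) (m := t + 1) (k := k)
    fun c h1 h2 => hdw c (by omega) h2
  have hvanti := lt_of_forall_step_int (f := w.symm) (m := t + 1) (k := k)
    fun c h1 h2 => hdv c (by omega) h2
  obtain ⟨x, hx⟩ : ∃ x, x = w.symm k := ⟨_, rfl⟩
  obtain ⟨y, hy⟩ : ∃ y, y = w.symm (k + 1) := ⟨_, rfl⟩
  have hwx : w x = k := by rw [hx, apply_symm_apply]
  have hwy : w y = k + 1 := by rw [hy, apply_symm_apply]
  rw [← hx, ← hy] at hv
  have hne : ∀ p q, w p ≠ w q → p ≠ q := fun p q h he => h (he ▸ rfl)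
  have hav := h.avoids
  have hvk : ∀ c, t < c → c < k → x < w.symm c := fun c h1 h2 => by
    rw [hx]
    exact hvanti c k (by omega) h2 le_rfl
  -- The value at `t` is at most `k`.
  have hwt : w t ≤ k := by
    by_contra hlt
    have hxt : x ≠ t := hne _ _ (by omega)
    have hxt' : x ≠ t + 1 := hne _ _ (by omega)
    have hxt2 : x < t := by
      by_contra hge
      have hyt : w t ≠ w y := w.injective.ne (by omega)
      exact hav.not3412 (lt_add_one t) (by omega) hv (by omega) (by omega) hw
    obtain ⟨j, j', hjj, hj, hwj, hwj'⟩ :=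
      exists_two_down_of_up h.fix (c := t) hxt hxt2.le (by omega) le_rfl (by omega)
    have hj1 : j ≠ t + 1 := hne _ _ (by omega)
    have hj2 : w j ≠ w j' := w.injective.ne hjj.ne
    have hdec : w j' < w j := by
      by_contra hle
      exact hav.not3412 (lt_add_one t) (by omega) hjj (by omega) (by omega) hw
    exact hav.not34521 hxt2 (lt_add_one t) (by omega) hjj hdec (by omega) (by omega) hw
  have hit : i ≠ t := hne _ _ (by omega)
  -- The value at `t + 1` is less than that at `i`.
  have hwi' : w (t + 1) < w i := by
    by_contra hge
    have hit1 : w i ≠ w (t + 1) := w.injective.ne (by omega)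
    obtain ⟨j, j', hjj, hj, hwj, hwj'⟩ := exists_two_down_of_up h.fix (c := k) (p := i)
      (p' := t + 1) (by omega) (by omega) hwi (by omega) (by omega)
    have hj2 : w j ≠ w j' := w.injective.ne hjj.ne
    have hdec : w j' < w j := by
      by_contra hle
      exact hav.not3412 (a := i) (b := t + 1) (by omega) (by omega) hjj (by omega) (by omega)
        (by omega)
    have hxi : x ≠ i := hne _ _ (by omega)
    have hxt' : x ≠ t + 1 := hne _ _ (by omega)
    have hxt2 : x ≤ t := by
      by_contra hge
      have hyt : w i ≠ w y := w.injective.ne (by omega)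
      exact hav.not3412 (a := i) (b := t + 1) (by omega) (by omega) hv (by omega) (by omega)
        (by omega)
    have hjx : w j ≠ w x := w.injective.ne (by omega)
    have hjx' : w j' ≠ w x := w.injective.ne (by omega)
    have hxi2 : i < x := by
      by_contra hle
      exact hav.not34521 (a := x) (b := i) (c := t + 1) (by omega) (by omega) (by omega) hjj hdec
        (by omega) (by omega) (by omega)
    have hyi : w i ≠ w y := w.injective.ne (by omega)
    have hyj : y ≠ j' := hne _ _ (by omega)
    rcases lt_or_gt_of_ne hyj with h1 | h1
    · exact hav.not4231 (a := i) (b := x) hxi2 hv h1 (by omega) (by omega) (by omega)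
    · exact hav.not3412 (a := i) (b := t + 1) (by omega) (by omega) h1 (by omega) (by omega)
        (by omega)
  have hai := (h.apply_mem (p := i) (by omega)).1
  have hib := (h.apply_mem' (p := i) (by omega)).2
  have hgt : ∀ j, t + 1 < j → w t < w j := by
    intro j hj
    by_contra hle
    have hjt : w j ≠ w t := w.injective.ne (by omega)
    exact hav.not4231 (a := i) (b := t) (by omega) (lt_add_one t) hj (by omega) hw hwi'
  obtain ⟨j₀, hj₀, hwj₀⟩ := h.down t (by omega) (by omega)
  obtain ⟨j₁, hj₁, hwj₁⟩ := h.down (t + 1) (by omega) (by omega)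
  have hwt1 := hgt j₁ hj₁
  -- The value `k` occurs after position `i`.
  have hxi : i < x := by
    have hxi : x ≠ i := hne _ _ (by omega)
    by_contra hle
    exact hav.not3412 (a := x) (b := i) (c := t) (d := j₁) (by omega) (by omega) (by omega) hwt1
      (by omega) (by omega)
  have hiy : w i ≠ w y := w.injective.ne (by omega)
  have hlty : ∀ j, w j < k → j < y := by
    intro j hj
    have hjy : j ≠ y := hne _ _ (by omega)
    by_contra hle
    exact hav.not4231 (a := i) (b := x) (c := y) (d := j) hxi hv (by omega) (by omega)
      (by omega) (by omega)
  have hlty' : ∀ j, w j ≤ k → j < y := by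
    intro j hj
    rcases eq_or_lt_of_le hj with h1 | h1
    · have : j = x := w.injective (by omega)
      omega
    · exact hlty j h1
  have hky : k + 1 < y := by
    obtain ⟨j, hj, hwj⟩ := exists_down_of_up h.fix (c := k) (p := i) (by omega) hwi
    have := hlty' j hwj
    omega
  obtain ⟨j', hj', hwj'⟩ := h.down (k + 1) (by omega) (by omega)
  have hj'y := hlty' j' (by omega)
  have hj₁y := hlty' j₁ (by omega)
  -- Apart from `i`, all positions up to `t` have values at most `k`.
  have huniq : ∀ p, p ≤ t → k < w p → p = i := by
    intro p hp hwp
    by_contra hpi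
    have hpt : p ≠ t := hne _ _ (by omega)
    have hpw : w p ≠ w i := w.injective.ne hpi
    have hpy : w p ≠ w y := w.injective.ne (by omega)
    rcases lt_or_gt_of_ne hpi with h1 | h1 <;> rcases lt_or_gt_of_ne hpw with h2 | h2
    · exact hav.not3412 (c := t) (d := j₁) h1 (by omega) (by omega) hwt1 (by omega) h2
    · exact hav.not54123 (c := t) (d := j₁) (e := y) h1 (by omega) (by omega) hj₁y hwt1 (by omega)
        (by omega) h2
    · exact hav.not54123 (c := t) (d := j₁) (e := y) h1 (by omega) (by omega) hj₁y hwt1 (by omega)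
        (by omega) h2
    · exact hav.not3412 (c := t) (d := j₁) h1 (by omega) (by omega) hwt1 (by omega) h2
  by_cases hcase : w (t + 1) ≤ k
  · -- Only one position up to `k`, namely `i`, has a value greater than `k`.
    have huniq' : ∀ p, p ≤ k → k < w p → p = i := by
      intro p hp hwp
      by_cases hpt : p ≤ t
      · exact huniq p hpt hwp
      · exfalso
        by_cases hpt1 : p = t + 1
        · subst hpt1
          omega
        · have := hwanti (t + 1) p le_rfl (by omega) hp
          omega
    have huniq2 : ∀ p, k < p → w p ≤ k → p = j' := by
      intro p hp hwp
      by_contra hpj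
      obtain ⟨q, q', hqq, h1, h2, h3, h4⟩ :=
        exists_two_up_of_down h.fix hpj hp hwp (by omega) (by omega)
      exact hqq ((huniq' q h1 h2).trans (huniq' q' h3 h4).symm)
    have hk1 : k < w (k + 1) := by
      by_contra hle
      have := huniq2 (k + 1) (by omega) (by omega)
      omega
    have hk1y : w (k + 1) ≠ w y := w.injective.ne (by omega)
    have hk1i : w (k + 1) ≠ w i := w.injective.ne (by omega)
    have hk1i' : w (k + 1) < w i := by
      by_contra hle
      exact hav.not3412 (a := i) (b := k + 1) (c := j') (d := y) (by omega) (by omega) hj'y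
        (by omega) (by omega) (by omega)
    have htj : w (t + 1) ≠ w j' := w.injective.ne (by omega)
    have htj' : w (t + 1) < w j' := by
      by_contra hle
      exact hav.not4231 (a := i) (b := t + 1) (c := k + 1) (d := j') (by omega) (by omega)
        (by omega) (by omega) (by omega) (by omega)
    rcases eq_or_lt_of_le (show w j' ≤ k by omega) with h1 | h1
    · have hj'x : j' = x := w.injective (by omega)
      have hkt : k = t + 1 := by
        by_contra hkt
        have h2 := hvk (t + 1) (by omega) (by omega)
        have h3 := huniq2 (w.symm (t + 1)) (by omega) (by rw [apply_symm_apply]; omega)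
        omega
      have := huniq2 j₁ (by omega) (by omega)
      subst this
      omega
    · have hxk : x ≤ k := by
        by_contra hxk
        have := huniq2 x (by omega) (by omega)
        subst this
        omega
      have hxt : x ≤ t := by
        by_contra hxt
        by_cases hxt1 : x = t + 1
        · subst hxt1
          omega
        · have := hwanti (t + 1) x le_rfl (by omega) hxk
          omega
      have hxt' : x ≠ t := hne _ _ (by omega)
      exact hav.not54123 (a := i) (b := x) (c := t) (d := t + 1) (e := j') hxi (by omega)
        (by omega) (by omega) hw htj' (by omega) (by omega)
  · have hxt : t + 1 < x := by
      have h1 : x ≠ t := hne _ _ (by omega)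
      have h2 : x ≠ t + 1 := hne _ _ (by omega)
      by_contra hle
      exact hav.not4231 (a := i) (b := x) (c := t + 1) (d := j₁) hxi (by omega) hj₁ (by omega)
        (by omega) hwi'
    -- Only one position after `t` has a value at most `t`.
    have huniq3 : ∀ p q, t < p → w p ≤ t → t < q → w q ≤ t → p = q := by
      intro p q hp hwp hq hwq
      by_contra hpq
      obtain ⟨r, r', hrr, h1, h2, h3, h4⟩ := exists_two_up_of_down h.fix hpq hp hwp hq hwq
      have key : ∀ r, r ≤ t → t < w r → r = i := by
        intro r h1 h2
        by_cases h5 : k < w r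
        · exact huniq r h1 h5
        · exfalso
          rcases eq_or_lt_of_le (not_lt.mp h5) with h6 | h6
          · have : r = x := w.injective (by omega)
            omega
          · have := hvk (w r) h2 h6
            rw [symm_apply_apply] at this
            omega
      exact hrr ((key r h1 h2).trans (key r' h3 h4).symm)
    obtain ⟨s, hs⟩ : ∃ s, w s = t := w.surjective t
    have hst : s ≤ t := by
      by_contra hst
      have := huniq3 s j₀ (by omega) (by omega) hj₀ (by omega)
      subst this
      omega
    have hj₀1 : j₀ ≠ t + 1 := hne _ _ (by omega)
    have hwtj := hgt j₀ (by omega)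
    have hst' : s ≠ t := hne _ _ (by omega)
    have hsi : s ≠ i := hne _ _ (by omega)
    rcases lt_or_gt_of_ne hsi with h1 | h1
    · exact hav.not3412 (a := s) (b := i) (c := t) (d := j₀) h1 (by omega) (by omega) hwtj
        (by omega) (by omega)
    · exact hav.not4231 (a := i) (b := s) (c := t + 1) (d := j₀) h1 (by omega) (by omega)
        (by omega) (by omega) hwi'

/-- For an ascent `t` of `w` and an ascent `k` of `w⁻¹` with `t ≤ k`, the positions up to `t` have
values at most `k`. -/
theorem IsInseparable.apply_le {w : Perm ℤ} {a b t k : ℤ} (h : IsInseparable w a b)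
    (hat : a ≤ t) (hkb : k < b) (htk : t ≤ k) (hw : w t < w (t + 1))
    (hv : w.symm k < w.symm (k + 1)) {i : ℤ} (hi : i ≤ t) : w i ≤ k := by
  by_contra hwi
  rw [not_le] at hwi
  induction hd : (k - t).toNat using Nat.strong_induction_on generalizing t k i with
  | _ d ih =>
    rcases eq_or_lt_of_le htk with rfl | htk
    · exact h.not_ascent hat hkb hw hv hi hwi
    · refine h.not_ascent_ascent hkb htk hw hv (fun c h1 h2 => ?_) (fun c h1 h2 => ?_) hi hwi
      · by_contra hc
        have hc' : w c ≠ w (c + 1) := w.injective.ne (by omega)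
        exact ih (k - c).toNat (by omega) (by omega) hkb h2.le (by omega) hv
          (by omega : i ≤ c) hwi rfl
      · by_contra hc
        have hc' : w.symm c ≠ w.symm (c + 1) := w.symm.injective.ne (by omega)
        exact ih (c - t).toNat (by omega) hat (by omega) h1.le hw (by omega) hi (by omega) rfl

theorem IsInseparable.lt_apply {w : Perm ℤ} {a b t k : ℤ} (h : IsInseparable w a b)
    (hak : a ≤ k) (htb : t < b) (hkt : k ≤ t) (hw : w t < w (t + 1))
    (hv : w.symm k < w.symm (k + 1)) {i : ℤ} (hi : t < i) : k < w i := by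
  have e1 : -(-t - 1) = t + 1 := by ring
  have e2 : -(-t - 1 + 1) = t := by ring
  have e3 : -(-k - 1) = k + 1 := by ring
  have e4 : -(-k - 1 + 1) = k := by ring
  have := h.negConj.apply_le (t := -t - 1) (k := -k - 1) (i := -i) (by omega) (by omega)
    (by omega) (by simp only [negConj_apply, e1, e2]; omega)
    (by simp only [negConj_symm_apply, e3, e4]; omega) (by omega)
  rw [negConj_apply, neg_neg] at this
  omega

/-! ### Extension of a permutation to the integers -/

/-- The positions of `Fin n` as a subtype of `ℤ`. -/
def finEquivInt (n : ℕ) : Fin n ≃ {x : ℤ // 0 ≤ x ∧ x < n} where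
  toFun p := ⟨p.val, by omega⟩
  invFun x := ⟨x.val.toNat, by omega⟩
  left_inv p := by simp
  right_inv x := Subtype.ext (by simpa using x.2.1)

/-- The extension of a permutation of `Fin n` to `ℤ` by the identity. -/
def toInt {n : ℕ} (w : Perm (Fin n)) : Perm ℤ := w.extendDomain (finEquivInt n)

theorem toInt_coe {n : ℕ} (w : Perm (Fin n)) (p : Fin n) : toInt w p.val = (w p).val :=
  w.extendDomain_apply_image (finEquivInt n) p

theorem toInt_of_not_mem {n : ℕ} (w : Perm (Fin n)) {x : ℤ} (hx : ¬ (0 ≤ x ∧ x < n)) :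
    toInt w x = x := w.extendDomain_apply_not_subtype (finEquivInt n) hx

theorem toInt_symm {n : ℕ} (w : Perm (Fin n)) : (toInt w).symm = toInt w⁻¹ := by
  change (toInt w)⁻¹ = _
  exact Perm.extendDomain_inv w (finEquivInt n)

theorem toInt_lt_toInt {n : ℕ} (w : Perm (Fin n)) {t : ℕ} (ht : t + 1 < n)
    (h : w ⟨t, by omega⟩ < w ⟨t + 1, ht⟩) : toInt w t < toInt w (t + 1) := by
  have h1 := toInt_coe w ⟨t, by omega⟩
  have h2 := toInt_coe w ⟨t + 1, ht⟩
  rw [Fin.lt_def] at h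
  push_cast at h1 h2
  omega

theorem AvoidsAll.toInt {n : ℕ} {w : Perm (Fin n)} (h : AvoidsAll w) :
    AvoidsAll (toInt w) := by
  by_cases hn : n = 0
  · have hid : ∀ p, BruhatGraph.toInt w p = p := fun p => toInt_of_not_mem w (by omega)
    constructor <;> simp only [hid] <;> intros <;> omega
  have hlift : ∀ x : ℤ, 0 ≤ x ∧ x < n → ∃ p : Fin n, (p.val : ℤ) = x ∧
      (⟨x.toNat % n, Nat.mod_lt _ (by omega)⟩ : Fin n) = p := by
    intro x hx
    refine ⟨⟨x.toNat, by omega⟩, by simp [hx.1], Fin.ext ?_⟩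
    exact Nat.mod_eq_of_lt (by omega)
  refine h.transfer {x : ℤ | 0 ≤ x ∧ x < n}
    (fun x => ⟨x.toNat % n, Nat.mod_lt _ (by omega)⟩) ?_ ?_ ?_
  · intro p hp q hq hpq
    obtain ⟨p, rfl, hp⟩ := hlift p hp
    obtain ⟨q, rfl, hq⟩ := hlift q hq
    simp only [hp, hq]
    rw [Fin.lt_def]
    omega
  · intro p hp q hq hpq
    obtain ⟨p, rfl, hp⟩ := hlift p hp
    obtain ⟨q, rfl, hq⟩ := hlift q hq
    rw [toInt_coe, toInt_coe] at hpq
    simp only [hp, hq]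
    rw [Fin.lt_def]
    omega
  · intro p hp q
    have h1 : BruhatGraph.toInt w p = p := toInt_of_not_mem w hp
    simp only [Set.mem_ofPred_eq] at hp
    by_cases hq : 0 ≤ q ∧ q < n
    · obtain ⟨q, rfl, -⟩ := hlift q hq
      rw [toInt_coe, h1]
      omega
    · have h2 : BruhatGraph.toInt w q = q := toInt_of_not_mem w hq
      rw [h1, h2]
      exact ⟨id, id⟩

/-! ### Lower intervals are stable under descents -/

theorem Le.inv {n : ℕ} {u v : Perm (Fin n)} (h : Le u v) : Le u⁻¹ v⁻¹ := by
  induction h with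
  | refl => exact Le.refl _
  | @tail b c _ h ih =>
    obtain ⟨t, ht, rfl, hl⟩ := h
    refine Relation.ReflTransGen.tail ih ⟨b * t * b⁻¹, ht.conj b, ?_, ?_⟩
    · obtain ⟨p, q, -, rfl⟩ := isReflection_iff.mp ht
      simp [mul_assoc]
    · rw [length_inv, length_inv]
      exact hl

theorem le_mul_of_descents {n : ℕ} {J : Set ℕ} {w y z : Perm (Fin n)}
    (hw : ∀ i : Fin (n - 1), i.val ∈ J → w (pos' i) < w (pos i)) (hy : Le y w)
    (hz : z ∈ blockStabilizer n J) : Le (y * z) w := by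
  induction hm : (inversions z).card using Nat.strong_induction_on generalizing z with
  | _ m ih =>
    by_cases hz1 : z = 1
    · rwa [hz1, mul_one]
    · obtain ⟨i, hi⟩ := exists_descent hz1
      have hiJ : i.val ∈ J := sameBlock_of_inversion hz hi i.val le_rfl (Nat.lt_succ_self _)
      have hlt := card_inversions_lt_mul_swap' z (pos_lt_pos' i) hi
      have h1 := ih _ (hm ▸ hlt) (mul_simple_mem hz hiJ) rfl
      have h2 : w = w * simple n i * simple n i := by
        rw [mul_assoc, simple_mul_self, mul_one]
      have h3 : (w * simple n i) (pos i) < (w * simple n i) (pos' i) := by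
        simpa [simple_eq_swap] using hw i hiJ
      rw [h2, le_mul_simple_iff h3] at h1 ⊢
      rw [← mul_assoc y, mul_assoc (y * z), simple_mul_self, mul_one] at h1
      exact h1.symm

/-! ### The inseparable case -/

/-- The indices of the simple reflections strictly between the positions `a` and `b`. -/
def indexInterval (a b : ℕ) : Set ℕ := {k | a ≤ k ∧ k < b}

/-- An inseparable permutation avoiding the four patterns is the maximal element of the double coset
`W_J W_J'`, for `J` and `J'` its left and right descents. -/
theorem exists_eq_blockElement {n : ℕ} {w : Perm (Fin n)} {a b : ℕ} (hbn : b < n)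
    (hmem : w ∈ blockStabilizer n (indexInterval a b)) (hav : AvoidsAll w)
    (hup : ∀ c : Fin n, a < c.val → c.val < b → ∃ p, p < c ∧ c < w p)
    (hdown : ∀ c : Fin n, a < c.val → c.val < b → ∃ p, c < p ∧ w p < c)
    (hcross : ∀ k, a ≤ k → k < b → ∃ p : Fin n, p.val ≤ k ∧ k < (w p).val) :
    ∃ x : Set (Fin (n - 1)) × Set (Fin (n - 1)),
      x.1 ∪ x.2 = {i | i.val ∈ indexInterval a b} ∧ w = blockElement x := by
  have hins : IsInseparable (toInt w) a b := by
    refine ⟨hav.toInt, fun p hp => ?_, fun c h1 h2 => ?_, fun c h1 h2 => ?_⟩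
    · by_cases hpn : 0 ≤ p ∧ p < n
      · lift p to ℕ using hpn.1
        have := toInt_coe w ⟨p, by omega⟩
        rw [this]
        have h3 := sameBlock_apply hmem ⟨p, by omega⟩
        by_contra hne
        rcases lt_or_gt_of_ne hne with h4 | h4
        · have h5 := h3.2 (p - 1) (by omega) (by simp only; omega)
          simp only [indexInterval, Set.mem_ofPred_eq] at h5
          omega
        · have h5 := h3.1 p le_rfl (by omega)
          have h6 := h3.1 ((w ⟨p, by omega⟩).val - 1) (by simp only; omega) (by omega)
          simp only [indexInterval, Set.mem_ofPred_eq] at h5 h6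
          omega
      · exact toInt_of_not_mem w hpn
    · lift c to ℕ using (by omega)
      obtain ⟨p, h3, h4⟩ := hup ⟨c, by omega⟩ (by simp only; omega) (by simp only; omega)
      rw [Fin.lt_def] at h3 h4
      simp only at h3 h4
      exact ⟨p.val, by omega, by rw [toInt_coe]; omega⟩
    · lift c to ℕ using (by omega)
      obtain ⟨p, h3, h4⟩ := hdown ⟨c, by omega⟩ (by simp only; omega) (by simp only; omega)
      rw [Fin.lt_def] at h3 h4
      simp only at h3 h4
      exact ⟨p.val, by omega, by rw [toInt_coe]; omega⟩
  let J : Set (Fin (n - 1)) := {i | w⁻¹ (pos' i) < w⁻¹ (pos i)}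
  let J' : Set (Fin (n - 1)) := {i | w (pos' i) < w (pos i)}
  have hasc : ∀ t (ht : t + 1 < n), t ∉ Fin.val '' J' → toInt w t < toInt w (t + 1) := by
    intro t ht h
    refine toInt_lt_toInt w ht (lt_of_le_of_ne ?_ (w.injective.ne (by simp)))
    by_contra hlt
    exact h ⟨⟨t, by omega⟩, not_le.mp hlt, rfl⟩
  have hasc' : ∀ t (ht : t + 1 < n), t ∉ Fin.val '' J →
      (toInt w).symm t < (toInt w).symm (t + 1) := by
    intro t ht h
    rw [toInt_symm]
    refine toInt_lt_toInt w⁻¹ ht (lt_of_le_of_ne ?_ (w⁻¹.injective.ne (by simp)))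
    by_contra hlt
    exact h ⟨⟨t, by omega⟩, not_le.mp hlt, rfl⟩
  have hle : ∀ t k, a ≤ t → t ≤ k → k < b → t ∉ Fin.val '' J' → k ∉ Fin.val '' J →
      ∀ p : Fin n, p.val ≤ t → (w p).val ≤ k := by
    intro t k h1 h2 h3 h4 h5 p hp
    have := hins.apply_le (t := t) (k := k) (i := p.val) (by omega) (by omega) (by omega)
      (hasc t (by omega) h4) (hasc' k (by omega) h5) (by omega)
    rw [toInt_coe] at this
    omega
  have hlt : ∀ t k, a ≤ k → k ≤ t → t < b → t ∉ Fin.val '' J' → k ∉ Fin.val '' J →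
      ∀ p : Fin n, t < p.val → k < (w p).val := by
    intro t k h1 h2 h3 h4 h5 p hp
    have := hins.lt_apply (t := t) (k := k) (i := p.val) (by omega) (by omega) (by omega)
      (hasc t (by omega) h4) (hasc' k (by omega) h5) (by omega)
    rw [toInt_coe] at this
    omega
  have hdesc : ∀ {x : Perm (Fin n)}, x ∈ blockStabilizer n (indexInterval a b) →
      ∀ i : Fin (n - 1), x (pos' i) < x (pos i) → i.val ∈ indexInterval a b := fun hx i hi =>
    sameBlock_of_inversion hx hi i.val le_rfl (Nat.lt_succ_self _)
  have hJS : J ⊆ {i | i.val ∈ indexInterval a b} := fun i hi =>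
    hdesc ((blockStabilizer n _).inv_mem hmem) i hi
  have hJS' : J' ⊆ {i | i.val ∈ indexInterval a b} := fun i hi => hdesc hmem i hi
  have hunion : J ∪ J' = {i | i.val ∈ indexInterval a b} := by
    refine (Set.union_subset hJS hJS').antisymm fun i hi => ?_
    by_contra hne
    have hni : i ∉ J ∧ i ∉ J' := by
      rw [Set.mem_union, not_or] at hne
      exact hne
    obtain ⟨p, hp, hwp⟩ := hcross i.val hi.1 hi.2
    have h1 : i.val ∉ Fin.val '' J := fun ⟨j, hj, he⟩ => hni.1 (Fin.ext he ▸ hj)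
    have h2 : i.val ∉ Fin.val '' J' := fun ⟨j, hj, he⟩ => hni.2 (Fin.ext he ▸ hj)
    have := hle i.val i.val hi.1 le_rfl hi.2 h2 h1 p hp
    omega
  refine ⟨(J, J'), hunion, ?_⟩
  have hz := isReversal_longest J'
  set z := longest J' with hzdef
  have hzS : z ∈ blockStabilizer n (indexInterval a b) := by
    refine blockStabilizer_mono ?_ hz.1
    rintro _ ⟨i, hi, rfl⟩
    exact hJS' hi
  have hwz := (blockStabilizer n (indexInterval a b)).mul_mem hmem hzS
  -- Sorting `w` within its descending runs gives an element of `W_J`.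
  have hv : w * z ∈ blockStabilizer n (Fin.val '' J) := by
    intro k hk p hp
    by_cases hkS : k ∈ indexInterval a b
    swap
    · exact hwz k hkS p hp
    by_contra hlt'
    rw [not_le] at hlt'
    have hmaps : ∀ p' : Fin n, k < p'.val → k < ((w * z) p').val := by
      intro p' hp'
      by_cases h1 : ∃ t, t ∉ Fin.val '' J' ∧ k ≤ t ∧ t < p'.val
      · obtain ⟨t, ht, hkt, htp⟩ := h1
        have h2 := (apply_le_iff hz.1 ht p').not.mpr (not_le.mpr htp)
        by_cases htb : t < b
        · exact hlt t k hkS.1 hkt htb ht hk _ (not_le.mp h2)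
        · have h3 := (apply_le_iff hwz (k := t) (fun h => htb h.2) p').not.mpr (not_le.mpr htp)
          omega
      by_cases h2 : ∃ t, t ∉ Fin.val '' J' ∧ p.val ≤ t ∧ t ≤ k
      · exfalso
        obtain ⟨t, ht, hpt, htk⟩ := h2
        by_cases hat : a ≤ t
        · have h3 := hle t k hat htk hkS.2 ht hk (z p) (hz.1 t ht p hpt)
          rw [Perm.mul_apply] at hlt'
          omega
        · have h3 := hwz t (fun h => hat h.1) p hpt
          omega
      · have hb : SameBlock (Fin.val '' J') p p' := by
          intro t h3 h4
          by_contra ht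
          rcases le_total t k with h5 | h5
          · exact h2 ⟨t, ht, h3, h5⟩
          · exact h1 ⟨t, ht, h5, h4⟩
        have hpp : p < p' := by
          rw [Fin.lt_def]
          omega
        have h3 := hz.2 p p' hpp hb
        have hb' : SameBlock (Fin.val '' J') p p' ∧ SameBlock (Fin.val '' J') p' p := by
          refine ⟨hb, fun k h1 h2 => ?_⟩
          rw [Fin.lt_def] at hpp
          omega
        have h4 := (SameBlock.symm_trans (sameBlock_apply hz.1 p').symm
          (SameBlock.symm_trans hb'.symm (sameBlock_apply hz.1 p))).1
        have h5 : w (z p) < w (z p') := by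
          refine lt_of_forall_step (fun p => OrderDual.toDual (w p)) h3 fun t ht h6 h7 => ?_
          obtain ⟨i, hi, rfl⟩ := h4 t h6 h7
          exact hi
        exact hlt'.trans h5
    have h1 := Perm.perm_symm_on_of_perm_on_finite (f := w * z)
      (p := fun p : Fin n => k < p.val) (fun p hp => hmaps p hp) hlt'
    rw [symm_apply_apply] at h1
    omega
  have hiff : ∀ {x : Perm (Fin n)}, Le x (blockElement (J, J')) ↔ ∃ y z,
      y ∈ blockStabilizer n (Fin.val '' J) ∧ z ∈ blockStabilizer n (Fin.val '' J') ∧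
        x = y * z :=
    le_mul_mul_iff (isReversal_longest _) (isReversal_longest_inter _ _) (isReversal_longest _)
  refine Le.antisymm (hiff.mpr ⟨w * z, z⁻¹, hv, (blockStabilizer n _).inv_mem hz.1,
    (mul_inv_cancel_right w z).symm⟩) ?_
  obtain ⟨x, y, hx, hy, hxy⟩ := hiff.mp (Le.refl (blockElement (J, J')))
  have h1 : Le y w := by
    have := le_mul_of_descents (J := Fin.val '' J') (w := w) ?_ (one_le w) hy
    · rwa [one_mul] at this
    · rintro i ⟨j, hj, he⟩
      rw [← Fin.ext he]
      exact hj
  have h2 : Le (y⁻¹ * x⁻¹) w⁻¹ := by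
    refine le_mul_of_descents (J := Fin.val '' J) ?_ h1.inv ((blockStabilizer n _).inv_mem hx)
    rintro i ⟨j, hj, he⟩
    rw [← Fin.ext he]
    exact hj
  have h3 := h2.inv
  rw [mul_inv_rev, inv_inv, inv_inv, inv_inv] at h3
  rw [hxy]
  exact h3

/-! ### Splitting a separable permutation -/

/-- If a permutation with support on `[a, b]` maps the positions before `c` to positions up to `c`,
it is the product of its patterns on the values up to `c` and on the positions from `c` on. -/
theorem exists_eq_mul_of_forall_le {n : ℕ} {w : Perm (Fin n)} {a b : ℕ} {c : Fin n}
    (hac : a < c.val) (hcb : c.val < b) (hmem : w ∈ blockStabilizer n (indexInterval a b))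
    (hav : AvoidsAll w) (hsep : ∀ p, p < c → w p ≤ c) :
    ∃ u v, w = u * v ∧ u ∈ blockStabilizer n (indexInterval a c.val) ∧
      v ∈ blockStabilizer n (indexInterval c.val b) ∧ AvoidsAll u ∧ AvoidsAll v := by
  obtain ⟨i, hci, hwi⟩ : ∃ i, c ≤ i ∧ w i ≤ c := by
    by_contra! h
    have h1 := Perm.perm_symm_on_of_perm_on_finite (f := w)
      (p := fun p : Fin n => c ≤ p) (fun p hp => (h p hp).le) (le_refl c)
    have h2 := h _ h1
    rw [apply_symm_apply] at h2
    exact lt_irrefl _ h2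
  let g : Fin n → Fin n := fun p => if p < c then w p else if p = c then w i else p
  have g1 : ∀ p, p < c → g p = w p := fun p hp => if_pos hp
  have g2 : g c = w i := by simp [g]
  have g3 : ∀ p, c < p → g p = p := fun p hp => by
    simp only [g]
    rw [if_neg (by order), if_neg (by order)]
  have gle : ∀ p, p ≤ c → g p ≤ c := by
    intro p hp
    rcases lt_or_eq_of_le hp with h | rfl
    · exact g1 p h ▸ hsep p h
    · exact g2 ▸ hwi
  have hginj : g.Injective := by
    have key : ∀ p q, p < q → g p ≠ g q := by
      intro p q hpq he
      rcases lt_trichotomy q c with h | rfl | h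
      · rw [g1 p (by order), g1 q h] at he
        exact hpq.ne (w.injective he)
      · rw [g1 p hpq, g2] at he
        exact (hpq.trans_le hci).ne (w.injective he)
      · rw [g3 q h] at he
        rcases lt_or_ge c p with h' | h'
        · rw [g3 p h'] at he
          exact hpq.ne he
        · have := gle p h'
          order
    intro p q he
    by_contra hne
    rcases lt_or_gt_of_ne hne with h | h
    · exact key p q h he
    · exact key q p h he.symm
  let u : Perm (Fin n) := Equiv.ofBijective g (Finite.injective_iff_bijective.mp hginj)
  have hu : ∀ p, u p = g p := fun _ => rfl
  let v : Perm (Fin n) := u⁻¹ * w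
  have huv : ∀ p, u (v p) = w p := fun p => apply_inv_apply u (w p)
  have v1 : ∀ p, p < c → v p = p := by
    intro p hp
    apply u.injective
    rw [huv, hu, g1 p hp]
  have v2 : ∀ p, c ≤ p → w p ≤ c → v p = c := by
    intro p hp hwp
    have h1 : v p ≤ c := by
      by_contra h1
      have := huv p
      rw [hu, g3 _ (not_le.mp h1)] at this
      order
    rcases lt_or_eq_of_le h1 with h2 | h2
    · have := huv p
      rw [hu, g1 _ h2] at this
      have := w.injective this
      order
    · exact h2
  have v3 : ∀ p, c < w p → v p = w p := by
    intro p hp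
    apply u.injective
    rw [huv, hu, g3 _ hp]
  have vge : ∀ p, c ≤ p → c ≤ v p := by
    intro p hp
    rcases le_or_gt (w p) c with h | h
    · exact (v2 p hp h).ge
    · exact v3 p h ▸ h.le
  have humem : u ∈ blockStabilizer n (indexInterval a c.val) := by
    intro k hk p hp
    rw [hu]
    have hk' : k < a ∨ c.val ≤ k := by
      by_contra! h
      exact hk h
    rcases hk' with h | h
    · rw [g1 p (by rw [Fin.lt_def]; omega)]
      exact hmem k (fun h' => by have := h'.1; omega) p hp
    · rcases le_or_gt p c with h' | h'
      · have := gle p h'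
        rw [Fin.le_def] at this
        omega
      · rwa [g3 p h']
  refine ⟨u, v, (mul_inv_cancel_left u w).symm, humem, ?_, ?_, ?_⟩
  · intro k hk p hp
    have hk' : k < c.val ∨ b ≤ k := by
      by_contra! h
      exact hk h
    rcases hk' with h | h
    · rwa [v1 p (by rw [Fin.lt_def]; omega)]
    · have h1 : k ∉ indexInterval a b := fun h' => by have := h'.2; omega
      have h2 : k ∉ indexInterval a c.val := fun h' => by have := h'.2; omega
      rw [← apply_le_iff humem h2, huv]
      exact hmem k h1 p hp
  · refine hav.transfer {p | p ≤ c} (fun p => if p < c then p else i) ?_ ?_ ?_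
    · intro p hp q hq hpq
      simp only [Set.mem_ofPred_eq] at hp hq
      rw [if_pos (by order)]
      split_ifs <;> order
    · intro p hp q hq hpq
      simp only [Set.mem_ofPred_eq] at hp hq
      have key : ∀ p, p ≤ c → u p = w (if p < c then p else i) := by
        intro p hp
        rw [hu]
        rcases lt_or_eq_of_le hp with h | rfl
        · rw [g1 p h, if_pos h]
        · rw [g2, if_neg (lt_irrefl _)]
      rwa [key p hp, key q hq] at hpq
    · intro p hp q
      simp only [Set.mem_ofPred_eq, not_le] at hp
      rw [hu, hu, g3 p hp]
      refine ⟨fun h => ?_, fun h => ?_⟩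
      · rcases le_or_gt q c with h' | h'
        · exact (gle q h').trans_lt hp
        · rwa [g3 q h']
      · rwa [g3 q (by order)]
  · refine hav.transfer {p | c ≤ p} id (fun p _ q _ h => h) ?_ ?_
    · intro p hp q hq hpq
      simp only [Set.mem_ofPred_eq] at hp hq
      simp only [id]
      rcases le_or_gt (w q) c with h' | h'
      · rw [v2 q hq h'] at hpq
        exact absurd (vge p hp) (not_le.mpr hpq)
      · rcases le_or_gt (w p) c with h | h
        · order
        · rwa [v3 p h, v3 q h'] at hpq
    · intro p hp q
      simp only [Set.mem_ofPred_eq, not_le] at hp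
      rw [v1 p hp]
      refine ⟨fun h => ?_, fun h => ?_⟩
      · rwa [v1 q (by order)]
      · rcases lt_or_ge q c with h' | h'
        · rwa [v1 q h']
        · exact hp.trans_le (vge q h')

/-! ### The factorization -/

/-- The permutation `w` is a product of elements `w₀(J) w₀(J ∩ J') w₀(J')` with disjoint connected
supports contained in `T`. -/
def IsBlockProduct {n : ℕ} (T : Set ℕ) (w : Perm (Fin n)) : Prop :=
  ∃ l : List (Set (Fin (n - 1)) × Set (Fin (n - 1))),
    (l.Pairwise fun x y => Disjoint (blockSupport x) (blockSupport y)) ∧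
    (∀ x ∈ l, blockSupport x ⊆ T ∧ ((dynkin n).induce (x.1 ∪ x.2)).Connected) ∧
    w = (l.map blockElement).prod

theorem isBlockProduct_one {n : ℕ} (T : Set ℕ) : IsBlockProduct T (1 : Perm (Fin n)) :=
  ⟨[], List.Pairwise.nil, by simp, rfl⟩

theorem IsBlockProduct.mul {n : ℕ} {A B T : Set ℕ} {u v : Perm (Fin n)} (hAB : Disjoint A B)
    (hu : IsBlockProduct A u) (hv : IsBlockProduct B v) (hA : A ⊆ T) (hB : B ⊆ T) :
    IsBlockProduct T (u * v) := by
  obtain ⟨l, hl1, hl2, rfl⟩ := hu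
  obtain ⟨m, hm1, hm2, rfl⟩ := hv
  refine ⟨l ++ m, ?_, ?_, by rw [List.map_append, List.prod_append]⟩
  · rw [List.pairwise_append]
    exact ⟨hl1, hm1, fun x hx y hy => hAB.mono (hl2 x hx).1 (hm2 y hy).1⟩
  · intro x hx
    rcases List.mem_append.mp hx with h | h
    · exact ⟨(hl2 x h).1.trans hA, (hl2 x h).2⟩
    · exact ⟨(hm2 x h).1.trans hB, (hm2 x h).2⟩

theorem IsBlockProduct.isAlmostPolished {n : ℕ} {T : Set ℕ} {w : Perm (Fin n)}
    (h : IsBlockProduct T w) : IsAlmostPolished w := by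
  obtain ⟨l, h1, h2, rfl⟩ := h
  refine ⟨l.length, fun i => (l.get i).1 ∪ (l.get i).2, fun i => (l.get i).1,
    fun i => (l.get i).2, fun i j hij => ?_, fun i => (h2 _ (l.get_mem i)).2, fun _ => rfl, ?_⟩
  · rw [← Set.disjoint_image_iff Fin.val_injective]
    rw [List.pairwise_iff_get] at h1
    rcases lt_or_gt_of_ne hij with h | h
    · exact h1 i j h
    · exact (h1 j i h).symm
  · have : (List.ofFn fun i : Fin l.length => blockElement (l.get i)) = l.map blockElement :=
      List.ofFn_getElem_eq_map l blockElement
    rw [← this]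
    rfl

theorem dynkin_adj_succ {n : ℕ} {i j : Fin (n - 1)} (h : j.val = i.val + 1) :
    (dynkin n).Adj i j := by
  rw [dynkin, SimpleGraph.fromRel_adj]
  refine ⟨fun he => by subst he; omega, Or.inl fun hc => ?_⟩
  have h1 : (pos j : Fin n) = pos' i := Fin.ext h
  have h2 := hc.eq
  rw [simple_eq_swap, simple_eq_swap, h1, swap_comm (pos i)] at h2
  refine swap_mul_swap_ne (pos_lt_pos' i).ne' ?_ ?_ h2
  · rw [← h1]
    exact (pos_lt_pos' j).ne
  · refine ((pos_lt_pos' i).trans ?_).ne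
    rw [← h1]
    exact pos_lt_pos' j

theorem dynkin_induce_connected {n a b : ℕ} (hab : a < b) (hbn : b < n) :
    ((dynkin n).induce {i : Fin (n - 1) | i.val ∈ indexInterval a b}).Connected := by
  rw [SimpleGraph.connected_iff_exists_forall_reachable]
  have hmem : ∀ k, a ≤ k → k < b → ∃ x : {i : Fin (n - 1) | i.val ∈ indexInterval a b},
      x.val.val = k := fun k h1 h2 => ⟨⟨⟨k, by omega⟩, h1, h2⟩, rfl⟩
  obtain ⟨x, hx⟩ := hmem a le_rfl hab
  refine ⟨x, fun y => ?_⟩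
  induction hm : y.val.val - a generalizing y with
  | zero =>
    have h1 := y.2.1
    have : x = y := Subtype.ext (Fin.ext (by omega))
    rw [this]
  | succ m ih =>
    have h2 := y.2.2
    obtain ⟨z, hz⟩ := hmem (y.val.val - 1) (by omega) (by omega)
    refine (ih z (by omega)).trans (SimpleGraph.Adj.reachable ?_)
    exact dynkin_adj_succ (i := z.val) (j := y.val) (by have := y.2.1; omega)

theorem disjoint_indexInterval (a b c : ℕ) : Disjoint (indexInterval a c) (indexInterval c b) :=
  Set.disjoint_left.mpr fun k h1 h2 => by
    have := h1.2
    have := h2.1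
    omega

theorem isBlockProduct_of_avoidsAll {n : ℕ} {w : Perm (Fin n)} {a b : ℕ} (hbn : b < n)
    (hmem : w ∈ blockStabilizer n (indexInterval a b)) (hav : AvoidsAll w) :
    IsBlockProduct (indexInterval a b) w := by
  induction hd : b - a using Nat.strong_induction_on generalizing a b w with
  | _ d ih =>
    by_cases hw1 : w = 1
    · rw [hw1]
      exact isBlockProduct_one _
    by_cases hup : ∀ c : Fin n, a < c.val → c.val < b → ∃ p, p < c ∧ c < w p
    swap
    · push Not at hup
      obtain ⟨c, hac, hcb, hsep⟩ := hup
      obtain ⟨u, v, rfl, hu, hv, hau, hav'⟩ := exists_eq_mul_of_forall_le hac hcb hmem hav hsep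
      exact (ih _ (by omega) c.isLt hu hau rfl).mul (disjoint_indexInterval a b c.val)
        (ih _ (by omega) hbn hv hav' rfl) (fun k hk => ⟨hk.1, hk.2.trans hcb⟩)
        (fun k hk => ⟨hac.le.trans hk.1, hk.2⟩)
    by_cases hdown : ∀ c : Fin n, a < c.val → c.val < b → ∃ p, c < p ∧ w p < c
    swap
    · push Not at hdown
      obtain ⟨c, hac, hcb, hsep⟩ := hdown
      have hsep' : ∀ p, p < c → w⁻¹ p ≤ c := by
        intro p hp
        by_contra h
        have := hsep _ (not_le.mp h)
        rw [apply_inv_apply] at this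
        order
      obtain ⟨u, v, huv, hu, hv, hau, hav'⟩ := exists_eq_mul_of_forall_le hac hcb
        ((blockStabilizer n _).inv_mem hmem) hav.symm hsep'
      have hw : w = v⁻¹ * u⁻¹ := by rw [← mul_inv_rev, ← huv, inv_inv]
      rw [hw]
      exact (ih _ (by omega) hbn ((blockStabilizer n _).inv_mem hv) hav'.symm rfl).mul
        (disjoint_indexInterval a b c.val).symm
        (ih _ (by omega) c.isLt ((blockStabilizer n _).inv_mem hu) hau.symm rfl)
        (fun k hk => ⟨hac.le.trans hk.1, hk.2⟩) (fun k hk => ⟨hk.1, hk.2.trans hcb⟩)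
    have hab : a < b := by
      by_contra hab
      refine hw1 (eq_one_of_mem_of_mem (B := ∅) (Set.disjoint_empty _) hmem ?_)
      refine blockStabilizer_mono ?_ hmem
      rintro k ⟨h1, h2⟩
      omega
    have hcross : ∀ k, a ≤ k → k < b → ∃ p : Fin n, p.val ≤ k ∧ k < (w p).val := by
      intro k h1 h2
      by_cases hak : a < k
      · obtain ⟨p, hp, hwp⟩ := hup ⟨k, by omega⟩ hak h2
        exact ⟨p, hp.le, hwp⟩
      by_cases hkb : k + 1 < b
      · obtain ⟨p, hp, hwp⟩ := hup ⟨k + 1, by omega⟩ (by simp only; omega) hkb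
        rw [Fin.lt_def] at hp hwp
        simp only at hp hwp
        exact ⟨p, by omega, by omega⟩
      · by_contra! h3
        refine hw1 (eq_one_of_mem_of_mem (B := ∅) (Set.disjoint_empty _) hmem ?_)
        intro j _ p hp
        by_cases hj : j = k
        · subst hj
          exact h3 p hp
        · refine hmem j ?_ p hp
          rintro ⟨h4, h5⟩
          omega
    obtain ⟨x, hx, hwx⟩ := exists_eq_blockElement hbn hmem hav hup hdown hcross
    refine ⟨[x], List.pairwise_singleton _ _, ?_, by simpa using hwx⟩
    intro y hy
    rw [List.mem_singleton] at hy
    subst hy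
    rw [blockSupport, hx]
    refine ⟨?_, dynkin_induce_connected hab hbn⟩
    rintro _ ⟨i, hi, rfl⟩
    exact hi

theorem isAlmostPolished_of_avoidsAll {n : ℕ} {w : Perm (Fin n)} (h : AvoidsAll w) :
    IsAlmostPolished w := by
  rcases Nat.eq_zero_or_pos n with rfl | hn
  · rw [Subsingleton.elim w 1]
    exact (isBlockProduct_one ∅).isAlmostPolished
  · refine (isBlockProduct_of_avoidsAll (a := 0) (b := n - 1) (by omega) ?_ h).isAlmostPolished
    intro k hk p hp
    have hk' : n - 1 ≤ k := by
      by_contra hk'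
      exact hk ⟨Nat.zero_le k, not_le.mp hk'⟩
    have := (w p).isLt
    omega

end BruhatGraph

theorem theorem1p3 (n : ℕ) (w : Equiv.Perm (Fin n)) :
    List.TFAE [
      BruhatGraph.IsVertexTransitive (BruhatGraph.intervalGraph 1 w),
      BruhatGraph.AvoidsPattern w ![3, 4, 1, 2] ∧
        BruhatGraph.AvoidsPattern w ![4, 2, 3, 1] ∧
        BruhatGraph.AvoidsPattern w ![3, 4, 5, 2, 1] ∧
        BruhatGraph.AvoidsPattern w ![5, 4, 1, 2, 3],
      BruhatGraph.IsAlmostPolished w] := by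
  tfae_have 1 → 2 := BruhatGraph.avoidsPattern_of_isVertexTransitive
  tfae_have 2 → 3 := fun h =>
    BruhatGraph.isAlmostPolished_of_avoidsAll (BruhatGraph.avoidsAll_of_avoidsPattern h)
  tfae_have 3 → 1 := BruhatGraph.IsAlmostPolished.isVertexTransitive
  tfae_finish
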